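/- Let $m\in\mathbb{N}$ and let $\mathbf{G}(x,\mathbf{y})=(G_1,\dots,G_m)$ be formal power series with real coefficients in the variables $x,y_1,\dots,y_m$. Let $J_{\mathbf G}$ be the $m\times m$ matrix of the formal partial derivatives $\partial G_i/\partial y_j$. Suppose that the system $\mathbf{y}=\mathbf{G}(x,\mathbf{y})$ is *well-conditioned*, that is: (a) every $G_i$ has nonnegative coefficients; (b) $\mathbf{G}$ is holomorphic in a neighborhood of the origin; (c) $\mathbf{G}(0,\mathbf{y})=\mathbf{0}$; (d) $G_i(x,\mathbf{0})\neq 0$ for all $i$; (e) $\det(I-J_{\mathbf G}(0,\mathbf{0}))\neq 0$; (f) the matrix $J_{\mathbf G}$ is irreducible, that is, the directed graph on $\{1,\dots,m\}$ with an edge $i\to j$ whenever $\partial G_i/\partial y_j\neq 0$ has a path of positive length from every vertex to every vertex; (g) $\partial^2 G_i/\partial y_j\partial y_k\neq 0$ for some $i,j,k$. An *extreme point* of the system is a pair $(\rho,\boldsymbol{\tau})\in\mathbb{R}\times\mathbb{R}^m$ for which there are formal power series $\mathbf{T}(x)=(T_1(x),\dots,T_m(x))$ with nonnegative coefficients and zero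 constant terms such that $\mathbf{T}(x)=\mathbf{G}(x,\mathbf{T}(x))$ formally, every $T_i$ has radius of convergence $\rho\in(0,\infty)$, and every $T_i(\rho)$ converges, with sum $\tau_i$. A *characteristic point* of the system is a pair $(a,\mathbf{b})$ with $a>0$ and all $b_i>0$ at which all the series $G_i$ and all the formal derivatives $\partial G_i/\partial y_j$ converge and which satisfies $\mathbf{b}=\mathbf{G}(a,\mathbf{b})$ and $\det(I-J_{\mathbf G}(a,\mathbf{b}))=0$; it may lie on the boundary of the domain of convergence. Then the system has exactly one extreme point $(\rho,\boldsymbol{\tau})$, and for every characteristic point $(a,\mathbf{b})$ of the system, the largest real eigenvalue of $J_{\mathbf G}(a,\mathbf{b})$ equals $1$ if and only if $(a,\mathbf{b})=(\rho,\boldsymbol{\tau})$. -/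

import Mathlib

/-- A system `y_i = G_i(x, y_1, …, y_m)`, `i = 1, …, m`, given by `m` formal power series with real
coefficients in the variables `x` (the index `none`) and `y_j` (the index `some j`). -/
abbrev PSSystem (m : ℕ) : Type :=
  Fin m → MvPowerSeries (Option (Fin m)) ℝ

namespace PSSystem

/-- The term of the power series `F` with exponent `d`, evaluated at `p`: the coefficient times the
product of the `p s ^ d s`. -/
noncomputable def term {σ : Type*} (F : MvPowerSeries σ ℝ) (p : σ → ℝ) (d : σ →₀ ℕ) : ℝ :=
  MvPowerSeries.coeff d F * d.prod fun s k => p s ^ k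

/-- The point `(a, b)` as an assignment of values to the variables `x, y_1, …, y_m`. -/
def point {m : ℕ} (a : ℝ) (b : Fin m → ℝ) : Option (Fin m) → ℝ :=
  fun s => s.elim a b

/-- The formal Jacobian, the `m × m` matrix of the formal power series `∂ G_i / ∂ y_j`. -/
noncomputable def formalJacobian {m : ℕ} (G : PSSystem m) (i j : Fin m) :
    MvPowerSeries (Option (Fin m)) ℝ :=
  MvPowerSeries.pderiv ℝ (some j) (G i)

/-- The Jacobian matrix `J_G(a, b)`: the entries are the values at `(a, b)` of the formal partial
derivatives `∂ G_i / ∂ y_j`. (It is used only where all of these series converge.) -/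
noncomputable def jacobian {m : ℕ} (G : PSSystem m) (a : ℝ) (b : Fin m → ℝ) :
    Matrix (Fin m) (Fin m) ℝ :=
  Matrix.of fun i j => ∑' d, term (formalJacobian G i j) (point a b) d

/-- `μ` is the largest real eigenvalue of the real square matrix `M`. -/
def IsLargestRealEigenvalue {m : ℕ} (M : Matrix (Fin m) (Fin m) ℝ) (μ : ℝ) : Prop :=
  IsGreatest {t : ℝ | Module.End.HasEigenvalue (Matrix.toLin' M) t} μ

/-- Well-conditioned systems. -/
structure WellConditioned {m : ℕ} (G : PSSystem m) : Prop where
  /-- Every `G_i` has nonnegative coefficients. -/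
  nonneg : ∀ i d, 0 ≤ MvPowerSeries.coeff d (G i)
  /-- The series `G_i` define holomorphic functions in a neighbourhood of the origin, that is, they
  converge (absolutely) on a complex polydisc around the origin. -/
  holomorphic : ∃ r : ℝ, 0 < r ∧ ∀ i, ∀ z : Option (Fin m) → ℂ, (∀ s, ‖z s‖ < r) →
    Summable fun d : Option (Fin m) →₀ ℕ =>
      ((MvPowerSeries.coeff d (G i) : ℝ) : ℂ) * d.prod fun s k => z s ^ k
  /-- `G(0, y) = 0`. -/
  zero_left : ∀ i, ∀ d : Option (Fin m) →₀ ℕ, d none = 0 → MvPowerSeries.coeff d (G i) = 0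
  /-- `G_i(x, 0) ≠ 0` for all `i`. -/
  ne_zero_right : ∀ i, ∃ n : ℕ, MvPowerSeries.coeff (Finsupp.single none n) (G i) ≠ 0
  /-- `det (I - J_G(0, 0)) ≠ 0`. -/
  det_ne_zero : (1 - jacobian G 0 0).det ≠ 0
  /-- The nonnegative matrix `J_G` is irreducible: in the directed graph with an edge `i → j` whenever
  the entry `∂ G_i / ∂ y_j` is not zero, there is a path from any vertex to any vertex. -/
  irreducible : ∀ i j, Relation.TransGen (fun k l => formalJacobian G k l ≠ 0) i j
  /-- The system is nonlinear in `y`. -/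
  nonlinear : ∃ i j k, MvPowerSeries.pderiv ℝ (some k) (MvPowerSeries.pderiv ℝ (some j) (G i)) ≠ 0

/-- The standard solution: power series `T_i(x)` with nonnegative coefficients (and constant term
zero, as is needed for the formal composition) with the formal identity `T(x) = G(x, T(x))`. -/
structure IsStandardSolution {m : ℕ} (G : PSSystem m) (T : Fin m → PowerSeries ℝ) : Prop where
  nonneg : ∀ i n, 0 ≤ PowerSeries.coeff n (T i)
  constantCoeff_eq_zero : ∀ i, PowerSeries.constantCoeff (T i) = 0
  eq_subst : ∀ i, T i = MvPowerSeries.subst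
    (fun s : Option (Fin m) => s.elim (PowerSeries.X : PowerSeries ℝ) T) (G i)

/-- The radius of convergence of the power series `f` is the real number `ρ`. -/
def HasRadiusOfConvergence (f : PowerSeries ℝ) (ρ : ℝ) : Prop :=
  (∀ x : ℝ, |x| < ρ → Summable fun n : ℕ => PowerSeries.coeff n f * x ^ n) ∧
  (∀ x : ℝ, ρ < |x| → ¬ Summable fun n : ℕ => PowerSeries.coeff n f * x ^ n)

/-- `(ρ, τ)` is the extreme point of the system: `ρ > 0` is the common radius of convergence of the
components of the standard solution `T`, and every `T_i(ρ)` converges, with sum `τ_i`. -/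
def IsExtremePoint {m : ℕ} (G : PSSystem m) (ρ : ℝ) (τ : Fin m → ℝ) : Prop :=
  ∃ T : Fin m → PowerSeries ℝ, IsStandardSolution G T ∧ 0 < ρ ∧
    ∀ i, HasRadiusOfConvergence (T i) ρ ∧ HasSum (fun n : ℕ => PowerSeries.coeff n (T i) * ρ ^ n) (τ i)

/-- `(a, b)` is a characteristic point: a positive solution of the characteristic system
`y = G(x, y)`, `det (I - J_G(x, y)) = 0`; in particular all the series in it converge at `(a, b)`. -/
structure IsCharacteristicPoint {m : ℕ} (G : PSSystem m) (a : ℝ) (b : Fin m → ℝ) : Prop where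
  pos_left : 0 < a
  pos_right : ∀ i, 0 < b i
  hasSum : ∀ i, HasSum (term (G i) (point a b)) (b i)
  summable_jacobian : ∀ i j, Summable (term (formalJacobian G i j) (point a b))
  det_eq_zero : (1 - jacobian G a b).det = 0

end PSSystem

/-! Since `G(0, y) = 0`, the map `T ↦ G(x, T)` is contracting for the `X`-adic topology, so there is
exactly one formal solution `S`. Evaluated in `[0, ∞]`, where no convergence has to be checked, it
satisfies `S(x) = G(x, S(x))` and lies below every supersolution (`eval_solution_le`).

Irreducibility bounds every component below by any other one, up to a factor `c x ^ n`. Together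
with nonlinearity this yields `c x ^ n S_i ^ 2 ≤ S_i`, so finite values satisfy `S_i ≤ 1 / (c x ^
n)`. Hence the components have a common finite radius `ρ`, and they converge there
(`exists_radius`).

The eigenvalue criterion rests on the fact that derivatives of series with nonnegative coefficients
are monotone. For `x < ρ` the vector `h = S(ρ) - S(x)` is positive and `J(x, S(x)) h < h`
(`jacobian_mulVec_sub_lt`). By comparison, no nonzero `w ≥ 0` satisfies `w ≤ J(x, S(x)) w`. An
eigenvalue above `1` at a characteristic point `(ρ, S(ρ))` would, by continuity from the left,
produce such a `w` for `x` near `ρ`.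

Conversely, let `(a, b)` be characteristic with largest real eigenvalue `1`. Minimality gives `S(a)
≤ b`, and `h = b - S(a)` satisfies `h ≤ J(a, b) h`. If `h ≠ 0`, Perron-Frobenius makes `h` a
positive fixed vector (`mulVec_eq_and_pos_of_le_mulVec`), whereas a nonzero second derivative makes
the inequality strict in some component. So `b = S(a)`, and the comparison above excludes `a < ρ`.
-/

open Matrix

/-! ### Perron-Frobenius theory through subinvariant vectors. -/

section NonnegativeMatrix

variable {ι : Type*} [Fintype ι]

/-- The smallest multiple `c v` lying above `w` touches it at an index maximizing `w i / v i`; there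
the inequality for `w` passes to `v`. In particular a positive `v` with `A v < v` excludes every
nonzero `w ≥ 0` with `w ≤ A w`. -/
theorem Matrix.exists_mul_le_mulVec_of_mul_le_mulVec {A : Matrix ι ι ℝ} (hA : ∀ i j, 0 ≤ A i j)
    {v w : ι → ℝ} (hv : ∀ i, 0 < v i) (hw : ∀ i, 0 ≤ w i) (hw0 : w ≠ 0) {r : ℝ}
    (h : ∀ i, r * w i ≤ (A *ᵥ w) i) : ∃ i, r * v i ≤ (A *ᵥ v) i := by
  obtain ⟨k, hk⟩ := Function.ne_iff.1 hw0
  obtain ⟨i, -, hi⟩ := Finset.exists_max_image Finset.univ (fun i => w i / v i) ⟨k, Finset.mem_univ k⟩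
  set c := w i / v i
  have hc0 : 0 < c :=
    (div_pos ((hw k).lt_of_ne' hk) (hv k)).trans_le (hi k (Finset.mem_univ k))
  have hle : ∀ j, w j ≤ c * v j := fun j => (div_le_iff₀ (hv j)).1 (hi j (Finset.mem_univ j))
  have heq : w i = c * v i := (div_mul_cancel₀ _ (hv i).ne').symm
  refine ⟨i, le_of_mul_le_mul_left ?_ hc0⟩
  calc c * (r * v i) = r * w i := by rw [heq]; ring
    _ ≤ (A *ᵥ w) i := h i
    _ ≤ c * (A *ᵥ v) i := by
      simp only [mulVec, dotProduct, Finset.mul_sum]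
      refine Finset.sum_le_sum fun j _ => ?_
      calc A i j * w j ≤ A i j * (c * v j) := mul_le_mul_of_nonneg_left (hle j) (hA i j)
        _ = c * (A i j * v j) := by ring

theorem Matrix.exists_pow_pos_of_transGen [DecidableEq ι] {A : Matrix ι ι ℝ}
    (hA : ∀ i j, 0 ≤ A i j) {i j : ι} (h : Relation.TransGen (fun k l => 0 < A k l) i j) :
    ∃ n, 0 < (A ^ n) i j := by
  induction h with
  | single h => exact ⟨1, by simpa using h⟩
  | @tail b c _ hbc ih =>
    obtain ⟨n, hn⟩ := ih
    refine ⟨n + 1, ?_⟩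
    rw [pow_succ, mul_apply]
    exact Finset.sum_pos' (fun k _ => mul_nonneg (pow_apply_nonneg hA n i k) (hA k c))
      ⟨b, Finset.mem_univ b, mul_pos hn hbc⟩

/-- Powers are summed because an irreducible matrix may be periodic, in which case no single power
is positive. -/
theorem Matrix.exists_pos_sum_pow [DecidableEq ι] {A : Matrix ι ι ℝ} (hA : ∀ i j, 0 ≤ A i j)
    (hirr : ∀ i j, Relation.TransGen (fun k l => 0 < A k l) i j) :
    ∃ N : ℕ, ∀ i j, 0 < (∑ n ∈ Finset.range N, A ^ n) i j := by
  choose f hf using fun i j => exists_pow_pos_of_transGen hA (hirr i j)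
  refine ⟨(Finset.univ.sup fun p : ι × ι => f p.1 p.2) + 1, fun i j => ?_⟩
  rw [sum_apply]
  refine Finset.sum_pos' (fun n _ => pow_apply_nonneg hA n i j) ⟨f i j, ?_, hf i j⟩
  exact Finset.mem_range.2 (Nat.lt_succ_of_le
    (Finset.le_sup (f := fun p : ι × ι => f p.1 p.2) (Finset.mem_univ (i, j))))

theorem Matrix.mulVec_pos {B : Matrix ι ι ℝ} (hB : ∀ i j, 0 < B i j) {w : ι → ℝ}
    (hw : ∀ i, 0 ≤ w i) (hw0 : w ≠ 0) (i : ι) : 0 < (B *ᵥ w) i := by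
  obtain ⟨k, hk⟩ := Function.ne_iff.1 hw0
  exact Finset.sum_pos' (fun j _ => mul_nonneg (hB i j).le (hw j))
    ⟨k, Finset.mem_univ k, mul_pos (hB i k) ((hw k).lt_of_ne' hk)⟩

/-- If a subinvariance inequality `r x ≤ A x` for an irreducible nonnegative matrix `A` is not an
equality, then the factor `r` can be increased. -/
theorem Matrix.exists_lt_mul_le_mulVec [DecidableEq ι] {A B : Matrix ι ι ℝ} (hAB : Commute A B)
    (hB : ∀ i j, 0 < B i j) {x : ι → ℝ} (hx : ∀ i, 0 ≤ x i) (hx0 : x ≠ 0) {r : ℝ}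
    (h : ∀ i, r * x i ≤ (A *ᵥ x) i) (hne : A *ᵥ x ≠ r • x) :
    ∃ s, r < s ∧ ∃ y : ι → ℝ, (∀ i, 0 ≤ y i) ∧ y ≠ 0 ∧ ∀ i, s * y i ≤ (A *ᵥ y) i := by
  have hy : ∀ i, 0 < (B *ᵥ x) i := mulVec_pos hB hx hx0
  have hz : ∀ i, 0 < (B *ᵥ (A *ᵥ x - r • x)) i :=
    mulVec_pos hB (fun i => by simpa using h i) (sub_ne_zero.2 hne)
  -- With `y = B x`, commutation gives `A y - r y = B (A x - r x)`, positive in every component;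
  -- this leaves room for a small `ε`.
  have hcomm : A *ᵥ (B *ᵥ x) = B *ᵥ (A *ᵥ x) := by
    rw [mulVec_mulVec, mulVec_mulVec, hAB.eq]
  have hev : ∀ᶠ ε in nhdsWithin (0 : ℝ) (Set.Ioi 0),
      ∀ i, ε * (B *ᵥ x) i < (B *ᵥ (A *ᵥ x - r • x)) i := by
    refine Filter.eventually_all.2 fun i => ?_
    have : Filter.Tendsto (fun ε : ℝ => ε * (B *ᵥ x) i) (nhdsWithin (0 : ℝ) (Set.Ioi 0))
        (nhds (0 * (B *ᵥ x) i)) :=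
      ((continuous_id.mul continuous_const).tendsto 0).mono_left nhdsWithin_le_nhds
    exact this.eventually_lt_const (by simpa using hz i)
  obtain ⟨ε, hε, hε0⟩ := (hev.and self_mem_nhdsWithin).exists
  obtain ⟨k, -⟩ := Function.ne_iff.1 hx0
  refine ⟨r + ε, lt_add_of_pos_right r hε0, B *ᵥ x, fun i => (hy i).le,
    fun h0 => (hy k).ne' (congrFun h0 k), fun i => ?_⟩
  have := hε i
  rw [mulVec_sub, mulVec_smul, ← hcomm, Pi.sub_apply, Pi.smul_apply, smul_eq_mul] at this
  linarith

/-- The largest factor in a subinvariance inequality for a nonnegative matrix is attained. -/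
theorem Matrix.exists_max_mul_le_mulVec {A : Matrix ι ι ℝ} (hA : ∀ i j, 0 ≤ A i j) [Nonempty ι] :
    ∃ (r : ℝ) (x : ι → ℝ), (∀ i, 0 ≤ x i) ∧ x ≠ 0 ∧ (∀ i, r * x i ≤ (A *ᵥ x) i) ∧
      ∀ (s : ℝ) (y : ι → ℝ), (∀ i, 0 ≤ y i) → y ≠ 0 → (∀ i, s * y i ≤ (A *ᵥ y) i) → s ≤ r := by
  classical
  set M := ∑ i, ∑ j, A i j
  have hM0 : 0 ≤ M := Finset.sum_nonneg fun i _ => Finset.sum_nonneg fun j _ => hA i j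
  -- Normalizing to the simplex makes the admissible pairs compact. The bound `M` comes from summing
  -- `s z ≤ A z` over the rows, as all `z j ≤ 1`.
  set K : Set (ℝ × (ι → ℝ)) := (Set.Icc 0 M ×ˢ stdSimplex ℝ ι) ∩
    {p | ∀ i, p.1 * p.2 i ≤ (A *ᵥ p.2) i}
  have hKc : IsCompact K := by
    refine (isCompact_Icc.prod (isCompact_stdSimplex ℝ ι)).inter_right ?_
    simp only [Set.ofPred_forall]
    refine isClosed_iInter fun i => isClosed_le ?_ ?_
    · fun_prop
    · simp only [mulVec, dotProduct]; fun_prop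
  have hmem : ∀ (s : ℝ) (y : ι → ℝ), 0 ≤ s → (∀ i, 0 ≤ y i) → y ≠ 0 →
      (∀ i, s * y i ≤ (A *ᵥ y) i) → ∃ z, (s, z) ∈ K := by
    intro s y hs hy hy0 h
    obtain ⟨k, hk⟩ := Function.ne_iff.1 hy0
    have hS : 0 < ∑ i, y i := Finset.sum_pos' (fun i _ => hy i)
      ⟨k, Finset.mem_univ k, (hy k).lt_of_ne' hk⟩
    set z : ι → ℝ := (∑ i, y i)⁻¹ • y with hz
    have hz0 : ∀ i, 0 ≤ z i := fun i => mul_nonneg (inv_nonneg.2 hS.le) (hy i)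
    have hz1 : ∑ i, z i = 1 := by
      simp only [hz, Pi.smul_apply, smul_eq_mul, ← Finset.mul_sum]
      exact inv_mul_cancel₀ hS.ne'
    have hzle : ∀ i, s * z i ≤ (A *ᵥ z) i := by
      intro i
      rw [hz, mulVec_smul, Pi.smul_apply, Pi.smul_apply, smul_eq_mul, smul_eq_mul,
        mul_left_comm]
      exact mul_le_mul_of_nonneg_left (h i) (inv_nonneg.2 hS.le)
    refine ⟨z, ⟨⟨⟨hs, ?_⟩, hz0, hz1⟩, hzle⟩⟩
    calc s = ∑ i, s * z i := by rw [← Finset.mul_sum, hz1, mul_one]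
      _ ≤ ∑ i, (A *ᵥ z) i := Finset.sum_le_sum fun i _ => hzle i
      _ ≤ M := by
        refine Finset.sum_le_sum fun i _ => Finset.sum_le_sum fun j _ => ?_
        refine mul_le_of_le_one_right (hA i j) ?_
        rw [← hz1]
        exact Finset.single_le_sum (fun i _ => hz0 i) (Finset.mem_univ j)
  obtain ⟨z, hz⟩ := hmem 0 (fun _ => 1) le_rfl (fun _ => zero_le_one)
    (Function.ne_iff.2 ⟨Classical.arbitrary ι, one_ne_zero⟩) fun i => by
      rw [zero_mul]
      exact Finset.sum_nonneg fun j _ => mul_nonneg (hA i j) zero_le_one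
  obtain ⟨⟨r, x⟩, hrx, hmax⟩ := hKc.exists_isMaxOn ⟨_, hz⟩ continuous_fst.continuousOn
  refine ⟨r, x, hrx.1.2.1, ?_, hrx.2, fun s y hy hy0 h => ?_⟩
  · rintro rfl
    simpa using hrx.1.2.2
  · rcases le_or_gt 0 s with hs | hs
    · obtain ⟨z, hz⟩ := hmem s y hs hy hy0 h
      exact hmax hz
    · exact hs.le.trans hrx.1.1.1

/-- A consequence of the Perron-Frobenius theorem: if all real eigenvalues of an irreducible
nonnegative matrix `A` are at most `1`, then a nonzero `h ≥ 0` with `h ≤ A h` is a positive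
fixed vector. -/
theorem Matrix.mulVec_eq_and_pos_of_le_mulVec [DecidableEq ι] {A : Matrix ι ι ℝ}
    (hA : ∀ i j, 0 ≤ A i j) (hirr : ∀ i j, Relation.TransGen (fun k l => 0 < A k l) i j)
    (heig : ∀ t, Module.End.HasEigenvalue (toLin' A) t → t ≤ 1)
    {h : ι → ℝ} (hh : ∀ i, 0 ≤ h i) (hh0 : h ≠ 0) (hle : ∀ i, h i ≤ (A *ᵥ h) i) :
    A *ᵥ h = h ∧ ∀ i, 0 < h i := by
  obtain ⟨k, -⟩ := Function.ne_iff.1 hh0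
  have : Nonempty ι := ⟨k⟩
  obtain ⟨N, hN⟩ := exists_pos_sum_pow hA hirr
  set B := ∑ n ∈ Finset.range N, A ^ n with hB
  have hAB : Commute A B := Commute.sum_right _ _ _ fun n _ => Commute.self_pow A n
  obtain ⟨r, x, hx, hx0, hrx, hmax⟩ := exists_max_mul_le_mulVec hA
  have hxe : A *ᵥ x = r • x := by
    by_contra hne
    obtain ⟨s, hs, y, hy, hy0, hsy⟩ := exists_lt_mul_le_mulVec hAB hN hx hx0 hrx hne
    exact hs.not_ge (hmax s y hy hy0 hsy)
  have hr : r ≤ 1 := heig r (Module.End.hasEigenvalue_of_hasEigenvector (x := x)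
    ⟨Module.End.mem_eigenspace_iff.2 (by rw [toLin'_apply, hxe]), hx0⟩)
  have hfix : A *ᵥ h = h := by
    by_contra hne
    obtain ⟨s, hs, y, hy, hy0, hsy⟩ := exists_lt_mul_le_mulVec hAB hN hh hh0 (r := 1)
      (by simpa using hle) (by simpa using hne)
    exact hs.not_ge ((hmax s y hy hy0 hsy).trans hr)
  -- A fixed vector satisfies `B h = N h`, while `B h` is positive everywhere.
  have hpow : ∀ n : ℕ, (A ^ n) *ᵥ h = h := by
    intro n
    induction n with
    | zero => simp
    | succ n ih => rw [pow_succ, ← mulVec_mulVec, hfix, ih]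
  have hBh : B *ᵥ h = (N : ℝ) • h := by
    rw [hB, sum_mulVec, Finset.sum_congr rfl fun n _ => hpow n, Finset.sum_const,
      Finset.card_range, Nat.cast_smul_eq_nsmul]
  refine ⟨hfix, fun i => (hh i).lt_of_ne' fun h0 => ?_⟩
  have := mulVec_pos hN hh hh0 i
  rw [hBh, Pi.smul_apply, h0, smul_zero] at this
  exact this.false

end NonnegativeMatrix

namespace PSSystem

/-! ### Monomials and their directional derivatives. -/

section Monomial

variable {σ : Type*} {R : Type*} [CommSemiring R]

/-- The value at `p` of the monomial with exponent `d`. -/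
def monomialValue (p : σ → R) (d : σ →₀ ℕ) : R :=
  d.prod fun s k => p s ^ k

theorem monomialValue_add (p : σ → R) (d e : σ →₀ ℕ) :
    monomialValue p (d + e) = monomialValue p d * monomialValue p e :=
  Finsupp.prod_add_index' (fun _ => pow_zero _) fun _ _ _ => pow_add _ _ _

theorem monomialValue_single (p : σ → R) (s : σ) (n : ℕ) :
    monomialValue p (Finsupp.single s n) = p s ^ n :=
  Finsupp.prod_single_index (pow_zero _)

theorem monomialValue_add_single (p : σ → R) (d : σ →₀ ℕ) (s : σ) :
    monomialValue p (d + Finsupp.single s 1) = p s * monomialValue p d := by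
  rw [monomialValue_add, monomialValue_single, pow_one, mul_comm]

end Monomial

section RealMonomial

variable {σ : Type*}

theorem term_eq (F : MvPowerSeries σ ℝ) (p : σ → ℝ) (d : σ →₀ ℕ) :
    term F p d = MvPowerSeries.coeff d F * monomialValue p d :=
  rfl

theorem monomialValue_nonneg {p : σ → ℝ} (hp : ∀ s, 0 ≤ p s) (d : σ →₀ ℕ) :
    0 ≤ monomialValue p d :=
  Finset.prod_nonneg fun s _ => pow_nonneg (hp s) _

theorem monomialValue_pos {p : σ → ℝ} (hp : ∀ s, 0 < p s) (d : σ →₀ ℕ) :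
    0 < monomialValue p d :=
  Finset.prod_pos fun s _ => pow_pos (hp s) _

theorem monomialValue_mono {p q : σ → ℝ} (hp : ∀ s, 0 ≤ p s) (hpq : ∀ s, p s ≤ q s)
    (d : σ →₀ ℕ) : monomialValue p d ≤ monomialValue q d :=
  Finset.prod_le_prod (fun s _ => pow_nonneg (hp s) _)
    fun s _ => pow_le_pow_left₀ (hp s) (hpq s) _

theorem finsupp_induction_add_single {motive : (σ →₀ ℕ) → Prop} (zero : motive 0)
    (add_single : ∀ d s, motive d → motive (d + Finsupp.single s 1)) (d : σ →₀ ℕ) : motive d := by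
  induction d using Finsupp.induction with
  | zero => exact zero
  | single_add s n f _ _ ih =>
    clear * - ih add_single
    induction n with
    | zero => simpa using ih
    | succ n ih' =>
      rw [Finsupp.single_add, add_right_comm]
      exact add_single _ _ ih'

variable [Fintype σ]

/-- The derivative at `p` in the direction `h` of the monomial with exponent `d`. -/
noncomputable def monomialDeriv (p h : σ → ℝ) (d : σ →₀ ℕ) : ℝ :=
  ∑ s, d s * monomialValue p (d - Finsupp.single s 1) * h s

theorem monomialDeriv_add_single (p h : σ → ℝ) (d : σ →₀ ℕ) (s : σ) :
    monomialDeriv p h (d + Finsupp.single s 1) =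
      p s * monomialDeriv p h d + h s * monomialValue p d := by
  classical
  have key : ∀ t, ((d + Finsupp.single s 1 : σ →₀ ℕ) t : ℝ) *
      monomialValue p (d + Finsupp.single s 1 - Finsupp.single t 1) * h t =
      p s * (d t * monomialValue p (d - Finsupp.single t 1) * h t) +
        if t = s then h s * monomialValue p d else 0 := by
    intro t
    -- The truncated subtraction is not an honest shift when `d t = 0`, but then the factor `d t`
    -- vanishes.
    have h1 : (d t : ℝ) * monomialValue p (d + Finsupp.single s 1 - Finsupp.single t 1) =
        d t * (p s * monomialValue p (d - Finsupp.single t 1)) := by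
      rcases Nat.eq_zero_or_pos (d t) with h0 | h0
      · simp [h0]
      · rw [tsub_add_eq_add_tsub (Finsupp.single_le_iff.2 h0) |>.symm,
          monomialValue_add_single]
    rw [Finsupp.add_apply, Nat.cast_add, add_mul, add_mul, h1]
    split_ifs with hts
    · subst hts
      rw [Finsupp.single_eq_same, add_tsub_cancel_right]
      push_cast
      ring
    · rw [Finsupp.single_eq_of_ne hts]
      push_cast
      ring
  rw [monomialDeriv, Finset.sum_congr rfl fun t _ => key t, Finset.sum_add_distrib,
    ← Finset.mul_sum, Finset.sum_ite_eq' Finset.univ s, if_pos (Finset.mem_univ s),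
    monomialDeriv]

theorem monomialDeriv_zero (p h : σ → ℝ) : monomialDeriv p h 0 = 0 := by
  simp [monomialDeriv]

/-- Monomials need not be convex, but their derivatives are monotone on the ordered segment from `u`
to `b`, so the derivative at the upper end dominates. With `B`, `U` the values at `b`, `u`, the
induction uses `b_s B - u_s U = b_s (B - U) + (b_s - u_s) U` and `U ≤ B`. -/
theorem monomialValue_sub_le {u b : σ → ℝ} (hu : ∀ s, 0 ≤ u s) (hub : ∀ s, u s ≤ b s)
    (d : σ →₀ ℕ) : monomialValue b d - monomialValue u d ≤ monomialDeriv b (b - u) d := by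
  induction d using finsupp_induction_add_single with
  | zero => simp [monomialDeriv_zero, monomialValue]
  | add_single d s ih =>
    rw [monomialDeriv_add_single, monomialValue_add_single, monomialValue_add_single]
    have h1 := mul_le_mul_of_nonneg_left ih ((hu s).trans (hub s))
    have h2 := mul_le_mul_of_nonneg_left (monomialValue_mono hu hub d) (sub_nonneg.2 (hub s))
    rw [Pi.sub_apply]
    linarith

theorem le_monomialValue_sub {u b : σ → ℝ} (hu : ∀ s, 0 ≤ u s) (hub : ∀ s, u s ≤ b s)
    (d : σ →₀ ℕ) : monomialDeriv u (b - u) d ≤ monomialValue b d - monomialValue u d := by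
  induction d using finsupp_induction_add_single with
  | zero => simp [monomialDeriv_zero, monomialValue]
  | add_single d s ih =>
    rw [monomialDeriv_add_single, monomialValue_add_single, monomialValue_add_single]
    have h1 := mul_le_mul_of_nonneg_left ih (hu s)
    have h2 := mul_le_mul_of_nonneg_left (monomialValue_mono hu hub d) (sub_nonneg.2 (hub s))
    rw [Pi.sub_apply]
    linarith

/-- The bound for the last factor `k` loses `b_k - u_k` times the growth of the remaining monomial,
which is positive because that monomial contains `j`. The case `j = k` is included. -/
theorem monomialValue_sub_lt {u b : σ → ℝ} (hu : ∀ s, 0 ≤ u s) (hub : ∀ s, u s ≤ b s)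
    (hb : ∀ s, 0 < b s) (d : σ →₀ ℕ) {j k : σ} (hj : u j < b j) (hk : u k < b k) :
    monomialValue b (d + Finsupp.single j 1 + Finsupp.single k 1) -
        monomialValue u (d + Finsupp.single j 1 + Finsupp.single k 1) <
      monomialDeriv b (b - u) (d + Finsupp.single j 1 + Finsupp.single k 1) := by
  rw [monomialDeriv_add_single, monomialValue_add_single _ _ k, monomialValue_add_single _ _ k]
  have h1 := mul_le_mul_of_nonneg_left (monomialValue_sub_le hu hub (d + Finsupp.single j 1))
    (hb k).le
  have h2 : monomialValue u (d + Finsupp.single j 1) < monomialValue b (d + Finsupp.single j 1) := by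
    rw [monomialValue_add_single, monomialValue_add_single]
    exact (mul_le_mul_of_nonneg_left (monomialValue_mono hu hub d) (hu j)).trans_lt
      (mul_lt_mul_of_pos_right hj (monomialValue_pos hb d))
  have h3 := mul_lt_mul_of_pos_left h2 (sub_pos.2 hk)
  rw [Pi.sub_apply]
  linarith

end RealMonomial

/-! ### First-order bounds for series with nonnegative coefficients. -/

section Series

variable {σ : Type*} {F : MvPowerSeries σ ℝ}

theorem term_nonneg (hF : ∀ d, 0 ≤ MvPowerSeries.coeff d F) {p : σ → ℝ} (hp : ∀ s, 0 ≤ p s)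
    (d : σ →₀ ℕ) : 0 ≤ term F p d :=
  mul_nonneg (hF d) (monomialValue_nonneg hp d)

theorem term_mono (hF : ∀ d, 0 ≤ MvPowerSeries.coeff d F) {p q : σ → ℝ} (hp : ∀ s, 0 ≤ p s)
    (hpq : ∀ s, p s ≤ q s) (d : σ →₀ ℕ) : term F p d ≤ term F q d :=
  mul_le_mul_of_nonneg_left (monomialValue_mono hp hpq d) (hF d)

theorem summable_term_of_le (hF : ∀ d, 0 ≤ MvPowerSeries.coeff d F) {p q : σ → ℝ}
    (hp : ∀ s, 0 ≤ p s) (hpq : ∀ s, p s ≤ q s) (h : Summable (term F q)) : Summable (term F p) :=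
  h.of_nonneg_of_le (term_nonneg hF hp) (term_mono hF hp hpq)

theorem tsum_term_lt (hF : ∀ d, 0 ≤ MvPowerSeries.coeff d F) {p q : σ → ℝ}
    (hp : ∀ s, 0 ≤ p s) (hpq : ∀ s, p s ≤ q s) (h : Summable (term F q)) {s : σ} {n : ℕ}
    (hn : n ≠ 0) (hFn : MvPowerSeries.coeff (Finsupp.single s n) F ≠ 0) (hs : p s < q s) :
    ∑' d, term F p d < ∑' d, term F q d := by
  refine (summable_term_of_le hF hp hpq h).tsum_lt_tsum (term_mono hF hp hpq)
    (i := Finsupp.single s n) ?_ h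
  rw [term_eq, term_eq, monomialValue_single, monomialValue_single]
  exact mul_lt_mul_of_pos_left (pow_lt_pow_left₀ hs (hp s) hn) ((hF _).lt_of_ne' hFn)

theorem coeff_pderiv_nonneg (hF : ∀ d, 0 ≤ MvPowerSeries.coeff d F) (s : σ) (d : σ →₀ ℕ) :
    0 ≤ MvPowerSeries.coeff d (MvPowerSeries.pderiv ℝ s F) := by
  rw [MvPowerSeries.coeff_pderiv]
  exact mul_nonneg (hF _) (by positivity)

/-- This is a reindexing by `d ↦ d + single s 1`; the exponents missed have `d s = 0`. No interior
point is needed, so boundary points are covered. -/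
theorem hasSum_coeff_mul_deriv {p : σ → ℝ} {s : σ}
    (h : Summable (term (MvPowerSeries.pderiv ℝ s F) p)) :
    HasSum (fun d : σ →₀ ℕ => MvPowerSeries.coeff d F *
      (d s * monomialValue p (d - Finsupp.single s 1)))
      (∑' d, term (MvPowerSeries.pderiv ℝ s F) p d) := by
  have hinj : Function.Injective fun d : σ →₀ ℕ => d + Finsupp.single s 1 :=
    add_left_injective _
  refine (hinj.hasSum_iff fun d hd => ?_).1 ?_
  · have : d s = 0 := by
      by_contra h0
      exact hd ⟨d - Finsupp.single s 1,
        tsub_add_cancel_of_le (Finsupp.single_le_iff.2 (Nat.pos_of_ne_zero h0))⟩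
    simp [this]
  · convert h.hasSum using 1
    funext d
    rw [Function.comp_apply, term_eq, MvPowerSeries.coeff_pderiv, add_tsub_cancel_right,
      Finsupp.add_apply, Finsupp.single_eq_same]
    push_cast
    ring

variable [Fintype σ]

/-- Summability is required only in directions used by `h`: a characteristic point provides it for
the `y`-derivatives but not for the `x`-derivative. -/
theorem hasSum_coeff_mul_monomialDeriv {p h : σ → ℝ}
    (hs : ∀ s, h s ≠ 0 → Summable (term (MvPowerSeries.pderiv ℝ s F) p)) :
    HasSum (fun d : σ →₀ ℕ => MvPowerSeries.coeff d F * monomialDeriv p h d)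
      (∑ s, (∑' d, term (MvPowerSeries.pderiv ℝ s F) p d) * h s) := by
  simp only [monomialDeriv, Finset.mul_sum]
  refine hasSum_sum fun s _ => ?_
  by_cases h0 : h s = 0
  · simp [h0]
  · simpa only [mul_assoc] using (hasSum_coeff_mul_deriv (hs s h0)).mul_right (h s)

theorem tsum_term_sub_le (hF : ∀ d, 0 ≤ MvPowerSeries.coeff d F) {u b : σ → ℝ}
    (hu : ∀ s, 0 ≤ u s) (hub : ∀ s, u s ≤ b s) (hb : Summable (term F b))
    (hs : ∀ s, u s ≠ b s → Summable (term (MvPowerSeries.pderiv ℝ s F) b)) :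
    ∑' d, term F b d - ∑' d, term F u d ≤
      ∑ s, (∑' d, term (MvPowerSeries.pderiv ℝ s F) b d) * (b s - u s) := by
  refine hasSum_le (fun d => ?_) (hb.hasSum.sub (summable_term_of_le hF hu hub hb).hasSum)
    (hasSum_coeff_mul_monomialDeriv (h := b - u) fun s h => hs s fun h' => h (by simp [h']))
  rw [term_eq, term_eq, ← mul_sub]
  exact mul_le_mul_of_nonneg_left (monomialValue_sub_le hu hub d) (hF d)

theorem le_tsum_term_sub (hF : ∀ d, 0 ≤ MvPowerSeries.coeff d F) {u b : σ → ℝ}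
    (hu : ∀ s, 0 ≤ u s) (hub : ∀ s, u s ≤ b s) (hb : Summable (term F b))
    (hs : ∀ s, u s ≠ b s → Summable (term (MvPowerSeries.pderiv ℝ s F) u)) :
    ∑ s, (∑' d, term (MvPowerSeries.pderiv ℝ s F) u d) * (b s - u s) ≤
      ∑' d, term F b d - ∑' d, term F u d := by
  refine hasSum_le (fun d => ?_)
    (hasSum_coeff_mul_monomialDeriv (h := b - u) fun s h => hs s fun h' => h (by simp [h']))
    (hb.hasSum.sub (summable_term_of_le hF hu hub hb).hasSum)
  rw [term_eq, term_eq, ← mul_sub]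
  exact mul_le_mul_of_nonneg_left (le_monomialValue_sub hu hub d) (hF d)

theorem tsum_term_sub_lt (hF : ∀ d, 0 ≤ MvPowerSeries.coeff d F) {u b : σ → ℝ}
    (hu : ∀ s, 0 ≤ u s) (hub : ∀ s, u s ≤ b s) (hb0 : ∀ s, 0 < b s) (hb : Summable (term F b))
    (hs : ∀ s, u s ≠ b s → Summable (term (MvPowerSeries.pderiv ℝ s F) b))
    {j k : σ} (hjk : MvPowerSeries.pderiv ℝ k (MvPowerSeries.pderiv ℝ j F) ≠ 0)
    (hj : u j < b j) (hk : u k < b k) :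
    ∑' d, term F b d - ∑' d, term F u d <
      ∑ s, (∑' d, term (MvPowerSeries.pderiv ℝ s F) b d) * (b s - u s) := by
  obtain ⟨d, hd⟩ := (MvPowerSeries.ne_zero_iff_exists_coeff_ne_zero _).1 hjk
  rw [MvPowerSeries.coeff_pderiv, MvPowerSeries.coeff_pderiv] at hd
  have hd' := left_ne_zero_of_mul (left_ne_zero_of_mul hd)
  refine hasSum_lt (i := d + Finsupp.single k 1 + Finsupp.single j 1) (fun d => ?_) ?_
    (hb.hasSum.sub (summable_term_of_le hF hu hub hb).hasSum)
    (hasSum_coeff_mul_monomialDeriv (h := b - u) fun s h => hs s fun h' => h (by simp [h']))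
  · rw [term_eq, term_eq, ← mul_sub]
    exact mul_le_mul_of_nonneg_left (monomialValue_sub_le hu hub d) (hF d)
  · rw [term_eq, term_eq, ← mul_sub]
    exact mul_lt_mul_of_pos_left (monomialValue_sub_lt hu hub hb0 d hk hj) ((hF _).lt_of_ne' hd')

end Series

end PSSystem

namespace PSSystem

/-! ### Existence and uniqueness of the formal solution. -/

section FormalSolution

variable {m : ℕ}

/-- The formal composition `G(x, T(x))`. -/
noncomputable def comp (G : PSSystem m) (T : Fin m → PowerSeries ℝ) (i : Fin m) : PowerSeries ℝ :=
  MvPowerSeries.subst (fun s : Option (Fin m) => s.elim (PowerSeries.X : PowerSeries ℝ) T) (G i)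

theorem hasSubst_elim {T : Fin m → PowerSeries ℝ} (hT : ∀ i, PowerSeries.constantCoeff (T i) = 0) :
    MvPowerSeries.HasSubst fun s : Option (Fin m) => s.elim (PowerSeries.X : PowerSeries ℝ) T := by
  refine MvPowerSeries.hasSubst_of_constantCoeff_zero fun s => ?_
  cases s with
  | none => exact PowerSeries.constantCoeff_X
  | some i => exact hT i

theorem coeff_comp (G : PSSystem m) {T : Fin m → PowerSeries ℝ}
    (hT : ∀ i, PowerSeries.constantCoeff (T i) = 0) (i : Fin m) (n : ℕ) :
    PowerSeries.coeff n (comp G T i) = ∑ᶠ d : Option (Fin m) →₀ ℕ, MvPowerSeries.coeff d (G i) *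
      PowerSeries.coeff n (monomialValue (fun s => s.elim (PowerSeries.X : PowerSeries ℝ) T) d) :=
  MvPowerSeries.coeff_subst (hasSubst_elim hT) (G i) (Finsupp.single () n)

theorem finite_support_coeff_comp (G : PSSystem m) {T : Fin m → PowerSeries ℝ}
    (hT : ∀ i, PowerSeries.constantCoeff (T i) = 0) (i : Fin m) (n : ℕ) :
    (Function.support fun d : Option (Fin m) →₀ ℕ => MvPowerSeries.coeff d (G i) *
      PowerSeries.coeff n
        (monomialValue (fun s => s.elim (PowerSeries.X : PowerSeries ℝ) T) d)).Finite :=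
  MvPowerSeries.coeff_subst_finite (hasSubst_elim hT) (G i) (Finsupp.single () n)

theorem coeff_mul_nonneg {f g : PowerSeries ℝ} (hf : ∀ n, 0 ≤ PowerSeries.coeff n f)
    (hg : ∀ n, 0 ≤ PowerSeries.coeff n g) (n : ℕ) : 0 ≤ PowerSeries.coeff n (f * g) := by
  rw [PowerSeries.coeff_mul]
  exact Finset.sum_nonneg fun p _ => mul_nonneg (hf _) (hg _)

theorem coeff_X_nonneg (n : ℕ) : 0 ≤ PowerSeries.coeff n (PowerSeries.X : PowerSeries ℝ) := by
  rw [PowerSeries.coeff_X]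
  split_ifs <;> norm_num

theorem coeff_elim_nonneg {T : Fin m → PowerSeries ℝ} (hT : ∀ i n, 0 ≤ PowerSeries.coeff n (T i))
    (s : Option (Fin m)) (n : ℕ) :
    0 ≤ PowerSeries.coeff n (s.elim (PowerSeries.X : PowerSeries ℝ) T) := by
  cases s with
  | none => exact coeff_X_nonneg n
  | some i => exact hT i n

theorem coeff_monomialValue_nonneg {σ : Type*} {a : σ → PowerSeries ℝ}
    (ha : ∀ s n, 0 ≤ PowerSeries.coeff n (a s)) (d : σ →₀ ℕ) :
    ∀ n, 0 ≤ PowerSeries.coeff n (monomialValue a d) := by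
  induction d using finsupp_induction_add_single with
  | zero =>
    intro n
    rw [monomialValue, Finsupp.prod_zero_index, PowerSeries.coeff_one]
    split_ifs <;> norm_num
  | add_single d s ih =>
    rw [monomialValue_add_single]
    exact coeff_mul_nonneg (ha s) ih

theorem coeff_comp_nonneg {G : PSSystem m} (hG : ∀ i d, 0 ≤ MvPowerSeries.coeff d (G i))
    {T : Fin m → PowerSeries ℝ} (hT0 : ∀ i, PowerSeries.constantCoeff (T i) = 0)
    (hT : ∀ i n, 0 ≤ PowerSeries.coeff n (T i)) (i : Fin m) (n : ℕ) :
    0 ≤ PowerSeries.coeff n (comp G T i) := by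
  rw [coeff_comp G hT0]
  exact finsum_nonneg fun d =>
    mul_nonneg (hG i d) (coeff_monomialValue_nonneg (coeff_elim_nonneg hT) d n)

theorem X_pow_dvd_monomialValue_sub {σ : Type*} {a b : σ → PowerSeries ℝ} {n : ℕ}
    (h : ∀ s, (PowerSeries.X : PowerSeries ℝ) ^ n ∣ a s - b s) (d : σ →₀ ℕ) :
    (PowerSeries.X : PowerSeries ℝ) ^ n ∣ monomialValue a d - monomialValue b d := by
  induction d using finsupp_induction_add_single with
  | zero => simp [monomialValue]
  | add_single d s ih =>
    rw [monomialValue_add_single, monomialValue_add_single]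
    have : a s * monomialValue a d - b s * monomialValue b d =
      (a s - b s) * monomialValue a d + b s * (monomialValue a d - monomialValue b d) := by ring
    rw [this]
    exact dvd_add ((h s).mul_right _) (ih.mul_left _)

/-- Since `G(0, y) = 0`, the map `T ↦ G(x, T)` is contracting for the `X`-adic topology. -/
theorem X_pow_succ_dvd_comp_sub {G : PSSystem m}
    (hG : ∀ i, ∀ d : Option (Fin m) →₀ ℕ, d none = 0 → MvPowerSeries.coeff d (G i) = 0)
    {S T : Fin m → PowerSeries ℝ} (hS : ∀ i, PowerSeries.constantCoeff (S i) = 0)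
    (hT : ∀ i, PowerSeries.constantCoeff (T i) = 0) {n : ℕ}
    (h : ∀ i, (PowerSeries.X : PowerSeries ℝ) ^ n ∣ S i - T i) (i : Fin m) :
    (PowerSeries.X : PowerSeries ℝ) ^ (n + 1) ∣ comp G S i - comp G T i := by
  rw [PowerSeries.X_pow_dvd_iff]
  intro k hk
  rw [map_sub, sub_eq_zero, coeff_comp G hS, coeff_comp G hT]
  refine finsum_congr fun d => ?_
  by_cases hd : d none = 0
  · rw [hG i d hd, zero_mul, zero_mul]
  · congr 1
    rw [← sub_eq_zero, ← map_sub]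
    refine PowerSeries.X_pow_dvd_iff.1 ?_ k hk
    -- Every surviving monomial contains `x`; this factor supplies the additional power of `X`.
    obtain ⟨e, rfl⟩ : ∃ e, d = e + Finsupp.single none 1 := ⟨d - Finsupp.single none 1,
      (tsub_add_cancel_of_le (Finsupp.single_le_iff.2 (Nat.pos_of_ne_zero hd))).symm⟩
    rw [monomialValue_add_single, monomialValue_add_single, Option.elim_none, Option.elim_none, ← mul_sub, pow_succ']
    refine mul_dvd_mul_left _ (X_pow_dvd_monomialValue_sub (fun s => ?_) e)
    cases s with
    | none => simp
    | some j => exact h j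

/-- The iterates of `T ↦ G(x, T)` from `0`. -/
noncomputable def iterate (G : PSSystem m) : ℕ → Fin m → PowerSeries ℝ
  | 0 => 0
  | n + 1 => comp G (iterate G n)

variable {G : PSSystem m}

theorem constantCoeff_comp (hG : G.WellConditioned) {T : Fin m → PowerSeries ℝ}
    (hT : ∀ i, PowerSeries.constantCoeff (T i) = 0) (i : Fin m) :
    PowerSeries.constantCoeff (comp G T i) = 0 := by
  have h := X_pow_succ_dvd_comp_sub hG.zero_left hT (T := 0) (fun i => by simp) (n := 0)
    (fun i => by simp) i
  have h0 : PowerSeries.constantCoeff (comp G 0 i) = 0 := by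
    rw [← PowerSeries.coeff_zero_eq_constantCoeff_apply, coeff_comp G (by simp)]
    refine finsum_eq_zero_of_forall_eq_zero fun d => ?_
    by_cases hd : d none = 0
    · rw [hG.zero_left i d hd, zero_mul]
    · rw [PowerSeries.coeff_zero_eq_constantCoeff_apply, monomialValue, map_finsuppProd,
        Finsupp.prod, Finset.prod_eq_zero (Finsupp.mem_support_iff.2 hd), mul_zero]
      simp [hd]
  rw [zero_add, pow_one, PowerSeries.X_dvd_iff, map_sub, h0, sub_zero] at h
  exact h

theorem constantCoeff_iterate (hG : G.WellConditioned) (n : ℕ) (i : Fin m) :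
    PowerSeries.constantCoeff (iterate G n i) = 0 := by
  induction n generalizing i with
  | zero => simp [iterate]
  | succ n ih => exact constantCoeff_comp hG ih i

theorem coeff_iterate_nonneg (hG : G.WellConditioned) (n : ℕ) (i : Fin m) (k : ℕ) :
    0 ≤ PowerSeries.coeff k (iterate G n i) := by
  induction n generalizing i k with
  | zero => simp [iterate]
  | succ n ih => exact coeff_comp_nonneg hG.nonneg (constantCoeff_iterate hG n) ih i k

theorem X_pow_dvd_iterate_sub (hG : G.WellConditioned) (n : ℕ) (i : Fin m) :
    (PowerSeries.X : PowerSeries ℝ) ^ n ∣ iterate G (n + 1) i - iterate G n i := by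
  induction n generalizing i with
  | zero => simp
  | succ n ih =>
    exact X_pow_succ_dvd_comp_sub hG.zero_left (constantCoeff_iterate hG _)
      (constantCoeff_iterate hG _) ih i

theorem coeff_iterate (hG : G.WellConditioned) {k n : ℕ} (hkn : k < n) (i : Fin m) :
    PowerSeries.coeff k (iterate G n i) = PowerSeries.coeff k (iterate G (k + 1) i) := by
  induction n, hkn using Nat.le_induction with
  | base => rfl
  | succ n hn ih =>
    rw [← ih, ← sub_eq_zero, ← map_sub]
    exact PowerSeries.X_pow_dvd_iff.1 (X_pow_dvd_iterate_sub hG n i) k hn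

/-- The unique formal solution of `T = G(x, T)`, the limit of the iterates. -/
noncomputable def solution (G : PSSystem m) (i : Fin m) : PowerSeries ℝ :=
  PowerSeries.mk fun n => PowerSeries.coeff n (iterate G (n + 1) i)

theorem coeff_solution (hG : G.WellConditioned) {k n : ℕ} (hkn : k < n) (i : Fin m) :
    PowerSeries.coeff k (solution G i) = PowerSeries.coeff k (iterate G n i) := by
  rw [solution, PowerSeries.coeff_mk, coeff_iterate hG hkn]

theorem isStandardSolution_solution (hG : G.WellConditioned) :
    IsStandardSolution G (solution G) := by
  have h0 : ∀ i, PowerSeries.constantCoeff (solution G i) = 0 := fun i => by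
    rw [← PowerSeries.coeff_zero_eq_constantCoeff_apply, coeff_solution hG zero_lt_one,
      PowerSeries.coeff_zero_eq_constantCoeff_apply, constantCoeff_iterate hG]
  refine ⟨fun i n => ?_, h0, fun i => ?_⟩
  · rw [coeff_solution hG n.lt_succ_self]
    exact coeff_iterate_nonneg hG _ _ _
  · change solution G i = comp G (solution G) i
    ext n
    rw [coeff_solution hG n.lt_succ_self]
    have h := X_pow_succ_dvd_comp_sub hG.zero_left (constantCoeff_iterate hG n) h0 (n := n)
      (fun j => PowerSeries.X_pow_dvd_iff.2 fun k hk => by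
        rw [map_sub, coeff_solution hG hk, sub_self]) i
    rw [← sub_eq_zero, ← map_sub]
    exact PowerSeries.X_pow_dvd_iff.1 h n n.lt_succ_self

theorem IsStandardSolution.eq_solution (hG : G.WellConditioned) {T : Fin m → PowerSeries ℝ}
    (hT : IsStandardSolution G T) : T = solution G := by
  have hS := isStandardSolution_solution hG
  have h : ∀ n i, (PowerSeries.X : PowerSeries ℝ) ^ n ∣ T i - solution G i := by
    intro n
    induction n with
    | zero => simp
    | succ n ih =>
      intro i
      rw [hT.eq_subst i, hS.eq_subst i]
      exact X_pow_succ_dvd_comp_sub hG.zero_left hT.constantCoeff_eq_zero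
        hS.constantCoeff_eq_zero ih i
  funext i
  ext n
  rw [← sub_eq_zero, ← map_sub]
  exact PowerSeries.X_pow_dvd_iff.1 (h (n + 1) i) n n.lt_succ_self

end FormalSolution

/-! ### Values of the solution in `[0, ∞]`. -/

section Evaluation

open scoped ENNReal

/-- The value at `x` of a power series with nonnegative coefficients, possibly infinite. -/
noncomputable def eval (f : PowerSeries ℝ) (x : ℝ≥0∞) : ℝ≥0∞ :=
  ∑' n, ENNReal.ofReal (PowerSeries.coeff n f) * x ^ n

theorem eval_mul {f g : PowerSeries ℝ} (hf : ∀ n, 0 ≤ PowerSeries.coeff n f)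
    (hg : ∀ n, 0 ≤ PowerSeries.coeff n g) (x : ℝ≥0∞) : eval (f * g) x = eval f x * eval g x := by
  simp only [eval]
  rw [← ENNReal.tsum_mul_right]
  simp only [← ENNReal.tsum_mul_left]
  rw [← ENNReal.tsum_prod, ← Finset.HasAntidiagonal.sigmaAntidiagonalEquivProd.tsum_eq, ENNReal.tsum_sigma']
  refine tsum_congr fun n => ?_
  rw [tsum_fintype, PowerSeries.coeff_mul,
    ENNReal.ofReal_sum_of_nonneg fun p _ => mul_nonneg (hf _) (hg _), Finset.sum_mul,
    ← Finset.sum_coe_sort]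
  refine Finset.sum_congr rfl fun p _ => ?_
  obtain ⟨⟨k, l⟩, hp⟩ := p
  change ENNReal.ofReal (PowerSeries.coeff k f * PowerSeries.coeff l g) * x ^ n =
    ENNReal.ofReal (PowerSeries.coeff k f) * x ^ k * (ENNReal.ofReal (PowerSeries.coeff l g) * x ^ l)
  rw [ENNReal.ofReal_mul (hf _), ← Finset.HasAntidiagonal.mem_antidiagonal.1 hp, pow_add]
  ring

theorem eval_X (x : ℝ≥0∞) : eval PowerSeries.X x = x := by
  rw [eval, tsum_eq_single 1 fun n hn => by simp [PowerSeries.coeff_X, hn]]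
  simp

theorem eval_monomialValue {σ : Type*} {a : σ → PowerSeries ℝ}
    (ha : ∀ s n, 0 ≤ PowerSeries.coeff n (a s)) (d : σ →₀ ℕ) (x : ℝ≥0∞) :
    eval (monomialValue a d) x = monomialValue (fun s => eval (a s) x) d := by
  induction d using finsupp_induction_add_single with
  | zero =>
    rw [monomialValue, monomialValue, Finsupp.prod_zero_index, Finsupp.prod_zero_index, eval,
      tsum_eq_single 0 fun n hn => by simp [PowerSeries.coeff_one, hn]]
    simp
  | add_single d s ih =>
    rw [monomialValue_add_single, monomialValue_add_single,
      eval_mul (ha s) (coeff_monomialValue_nonneg ha d), ih]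

/-- The value at `p` of a multivariate power series with nonnegative coefficients, possibly
infinite. -/
noncomputable def mvEval {σ : Type*} (F : MvPowerSeries σ ℝ) (p : σ → ℝ≥0∞) : ℝ≥0∞ :=
  ∑' d, ENNReal.ofReal (MvPowerSeries.coeff d F) * monomialValue p d

theorem monomialValue_mono_ennreal {σ : Type*} {p q : σ → ℝ≥0∞} (h : ∀ s, p s ≤ q s)
    (d : σ →₀ ℕ) : monomialValue p d ≤ monomialValue q d :=
  Finset.prod_le_prod' fun s _ => pow_le_pow_left' (h s) _

theorem mvEval_mono {σ : Type*} (F : MvPowerSeries σ ℝ) {p q : σ → ℝ≥0∞} (h : ∀ s, p s ≤ q s) :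
    mvEval F p ≤ mvEval F q :=
  ENNReal.tsum_le_tsum fun d => mul_le_mul_right (monomialValue_mono_ennreal h d) _

variable {m : ℕ} {G : PSSystem m}

/-- Sums in `[0, ∞]` may be interchanged freely, and each coefficient of the composition is a finite
sum, so `ENNReal.ofReal` passes through it. -/
theorem eval_comp (hG : G.WellConditioned) {T : Fin m → PowerSeries ℝ}
    (hT0 : ∀ i, PowerSeries.constantCoeff (T i) = 0)
    (hT : ∀ i n, 0 ≤ PowerSeries.coeff n (T i)) (i : Fin m) (x : ℝ≥0∞) :
    eval (comp G T i) x = mvEval (G i) fun s => s.elim x fun j => eval (T j) x := by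
  have hval : ∀ d : Option (Fin m) →₀ ℕ,
      eval (monomialValue (fun s => s.elim (PowerSeries.X : PowerSeries ℝ) T) d) x =
        monomialValue (fun s : Option (Fin m) => s.elim x fun j => eval (T j) x) d := by
    intro d
    rw [eval_monomialValue (coeff_elim_nonneg hT)]
    congr 1
    funext s
    cases s with
    | none => exact eval_X x
    | some j => rfl
  rw [eval, mvEval]
  simp only [← hval]
  simp only [eval, ← ENNReal.tsum_mul_left]
  rw [ENNReal.tsum_comm]
  refine tsum_congr fun n => ?_
  have hnn : ∀ d : Option (Fin m) →₀ ℕ, 0 ≤ MvPowerSeries.coeff d (G i) * PowerSeries.coeff n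
      (monomialValue (fun s => s.elim (PowerSeries.X : PowerSeries ℝ) T) d) := fun d =>
    mul_nonneg (hG.nonneg i d) (coeff_monomialValue_nonneg (coeff_elim_nonneg hT) d n)
  have hfin := finite_support_coeff_comp G hT0 i n
  rw [coeff_comp G hT0, finsum_eq_sum _ hfin,
    ENNReal.ofReal_sum_of_nonneg fun d _ => hnn d, Finset.sum_mul, tsum_eq_sum]
  · refine Finset.sum_congr rfl fun d _ => ?_
    rw [ENNReal.ofReal_mul (hG.nonneg i d), mul_assoc]
  · intro d hd
    rw [← mul_assoc, ← ENNReal.ofReal_mul (hG.nonneg i d)]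
    have : MvPowerSeries.coeff d (G i) * PowerSeries.coeff n
        (monomialValue (fun s => s.elim (PowerSeries.X : PowerSeries ℝ) T) d) = 0 :=
      of_not_not fun h => hd (hfin.mem_toFinset.2 h)
    rw [this, ENNReal.ofReal_zero, zero_mul]

theorem eval_solution (hG : G.WellConditioned) (i : Fin m) (x : ℝ≥0∞) :
    eval (solution G i) x = mvEval (G i) fun s => s.elim x fun j => eval (solution G j) x := by
  have h := isStandardSolution_solution hG
  rw [← eval_comp hG h.constantCoeff_eq_zero h.nonneg]
  exact congrArg (eval · x) (h.eq_subst i)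

/-- By monotonicity the iterates from `0` stay below any supersolution, and each partial sum of the
solution is a partial sum of an iterate. -/
theorem eval_solution_le (hG : G.WellConditioned) {x : ℝ≥0∞} {b : Fin m → ℝ≥0∞}
    (h : ∀ i, mvEval (G i) (fun s => s.elim x b) ≤ b i) (i : Fin m) :
    eval (solution G i) x ≤ b i := by
  have hit : ∀ n i, eval (iterate G n i) x ≤ b i := by
    intro n
    induction n with
    | zero => intro i; simp [iterate, eval]
    | succ n ih =>
      intro i
      rw [iterate, eval_comp hG (constantCoeff_iterate hG n) (coeff_iterate_nonneg hG n)]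
      refine (mvEval_mono _ fun s => ?_).trans (h i)
      cases s with
      | none => exact le_rfl
      | some j => exact ih j
  rw [eval, ENNReal.tsum_eq_iSup_nat]
  refine iSup_le fun n => le_trans ?_ (hit n i)
  rw [Finset.sum_congr rfl fun k hk => by rw [coeff_solution hG (Finset.mem_range.1 hk)]]
  exact ENNReal.sum_le_tsum _

end Evaluation

end PSSystem

namespace PSSystem

open scoped ENNReal

variable {m : ℕ} {G : PSSystem m}

/-! ### Mutual bounds between components from irreducibility and nonlinearity. -/

section LowerBounds

/-- `G_i` dominates each of its terms at the solution. -/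
theorem term_le_eval_solution (hG : G.WellConditioned) (i : Fin m) (d : Option (Fin m) →₀ ℕ)
    (x : ℝ≥0∞) :
    ENNReal.ofReal (MvPowerSeries.coeff d (G i)) *
      monomialValue (fun s => s.elim x fun j => eval (solution G j) x) d ≤
        eval (solution G i) x := by
  rw [eval_solution hG i x]
  exact ENNReal.le_tsum d

theorem ofReal_coeff_ne_zero (hG : G.WellConditioned) {i : Fin m} {d : Option (Fin m) →₀ ℕ}
    (h : MvPowerSeries.coeff d (G i) ≠ 0) : ENNReal.ofReal (MvPowerSeries.coeff d (G i)) ≠ 0 :=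
  (ENNReal.ofReal_pos.2 ((hG.nonneg i d).lt_of_ne' h)).ne'

theorem exists_coeff_single_ne_zero (hG : G.WellConditioned) (i : Fin m) :
    ∃ n ≠ 0, MvPowerSeries.coeff (Finsupp.single none n) (G i) ≠ 0 := by
  obtain ⟨n, hn⟩ := hG.ne_zero_right i
  refine ⟨n, ?_, hn⟩
  rintro rfl
  exact hn (hG.zero_left i _ (by simp))

theorem exists_mul_pow_le_eval (hG : G.WellConditioned) (i : Fin m) :
    ∃ c : ℝ≥0∞, c ≠ 0 ∧ ∃ n ≠ 0, ∀ x, c * x ^ n ≤ eval (solution G i) x := by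
  obtain ⟨n, hn, h⟩ := exists_coeff_single_ne_zero hG i
  refine ⟨_, ofReal_coeff_ne_zero hG h, n, hn, fun x => ?_⟩
  simpa [monomialValue_single] using term_le_eval_solution hG i (Finsupp.single none n) x

theorem exists_mul_pow_le_monomialValue (hG : G.WellConditioned) (d : Option (Fin m) →₀ ℕ) :
    ∃ c : ℝ≥0∞, c ≠ 0 ∧ ∃ n, ∀ x,
      c * x ^ n ≤ monomialValue (fun s => s.elim x fun j => eval (solution G j) x) d := by
  induction d using finsupp_induction_add_single with
  | zero => exact ⟨1, one_ne_zero, 0, fun x => by simp [monomialValue]⟩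
  | add_single d s ih =>
    obtain ⟨c, hc, n, h⟩ := ih
    obtain ⟨c', hc', n', h'⟩ : ∃ c : ℝ≥0∞, c ≠ 0 ∧ ∃ n, ∀ x,
        c * x ^ n ≤ s.elim x fun j => eval (solution G j) x := by
      cases s with
      | none => exact ⟨1, one_ne_zero, 1, fun x => by simp⟩
      | some j =>
        obtain ⟨c, hc, n, -, h⟩ := exists_mul_pow_le_eval hG j
        exact ⟨c, hc, n, h⟩
    refine ⟨c' * c, mul_ne_zero hc' hc, n' + n, fun x => ?_⟩
    rw [monomialValue_add_single]
    calc c' * c * x ^ (n' + n) = c' * x ^ n' * (c * x ^ n) := by ring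
      _ ≤ _ := mul_le_mul' (h' x) (h x)

theorem exists_mul_pow_mul_le_of_formalJacobian_ne_zero (hG : G.WellConditioned) {i j : Fin m}
    (h : formalJacobian G i j ≠ 0) : ∃ c : ℝ≥0∞, c ≠ 0 ∧ ∃ n, ∀ x,
      c * x ^ n * eval (solution G j) x ≤ eval (solution G i) x := by
  obtain ⟨d, hd⟩ := (MvPowerSeries.ne_zero_iff_exists_coeff_ne_zero _).1 h
  rw [formalJacobian, MvPowerSeries.coeff_pderiv] at hd
  obtain ⟨c, hc, n, hn⟩ := exists_mul_pow_le_monomialValue hG d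
  refine ⟨_, mul_ne_zero (ofReal_coeff_ne_zero hG (left_ne_zero_of_mul hd)) hc, n, fun x => ?_⟩
  refine le_trans ?_ (term_le_eval_solution hG i (d + Finsupp.single (some j) 1) x)
  rw [monomialValue_add_single, mul_assoc, mul_assoc, Option.elim_some, ← mul_assoc c, mul_comm (c * _)]
  gcongr
  exact hn x

theorem exists_mul_pow_mul_eval_le (hG : G.WellConditioned) (i j : Fin m) :
    ∃ c : ℝ≥0∞, c ≠ 0 ∧ ∃ n, ∀ x,
      c * x ^ n * eval (solution G j) x ≤ eval (solution G i) x := by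
  induction hG.irreducible i j with
  | single h => exact exists_mul_pow_mul_le_of_formalJacobian_ne_zero hG h
  | tail _ h ih =>
    obtain ⟨c, hc, n, hn⟩ := ih
    obtain ⟨c', hc', n', hn'⟩ := exists_mul_pow_mul_le_of_formalJacobian_ne_zero hG h
    refine ⟨c * c', mul_ne_zero hc hc', n + n', fun x => le_trans ?_ (hn x)⟩
    calc _ = c * x ^ n * (c' * x ^ n' * _) := by ring
      _ ≤ _ := mul_le_mul_right (hn' x) _

/-- Some `G_l` has a term divisible by `y_j y_k`. Irreducibility bounds `S_i` below by `S_l`, and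
both `S_j` and `S_k` below by `S_i`. -/
theorem exists_mul_pow_mul_eval_sq_le (hG : G.WellConditioned) (i : Fin m) :
    ∃ c : ℝ≥0∞, c ≠ 0 ∧ ∃ n, ∀ x,
      c * x ^ n * eval (solution G i) x ^ 2 ≤ eval (solution G i) x := by
  obtain ⟨l, j, k, h⟩ := hG.nonlinear
  obtain ⟨d, hd⟩ := (MvPowerSeries.ne_zero_iff_exists_coeff_ne_zero _).1 h
  rw [MvPowerSeries.coeff_pderiv, MvPowerSeries.coeff_pderiv] at hd
  have hd' := ofReal_coeff_ne_zero hG (left_ne_zero_of_mul (left_ne_zero_of_mul hd))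
  obtain ⟨c₁, hc₁, n₁, h₁⟩ := exists_mul_pow_mul_eval_le hG i l
  obtain ⟨c₂, hc₂, n₂, h₂⟩ := exists_mul_pow_mul_eval_le hG j i
  obtain ⟨c₃, hc₃, n₃, h₃⟩ := exists_mul_pow_mul_eval_le hG k i
  obtain ⟨c₄, hc₄, n₄, h₄⟩ := exists_mul_pow_le_monomialValue hG d
  set e := d + Finsupp.single (some k) 1 + Finsupp.single (some j) 1 with he
  set C := ENNReal.ofReal (MvPowerSeries.coeff e (G l))
  refine ⟨c₁ * C * c₂ * c₃ * c₄, ?_, n₁ + n₂ + n₃ + n₄, fun x => le_trans ?_ (h₁ x)⟩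
  · simp only [ne_eq, mul_eq_zero, not_or]
    exact ⟨⟨⟨⟨hc₁, hd'⟩, hc₂⟩, hc₃⟩, hc₄⟩
  · calc _ = c₁ * x ^ n₁ * (C * (c₂ * x ^ n₂ * eval (solution G i) x *
          (c₃ * x ^ n₃ * eval (solution G i) x * (c₄ * x ^ n₄)))) := by ring
      _ ≤ c₁ * x ^ n₁ * (C * (eval (solution G j) x * (eval (solution G k) x *
          monomialValue (fun s => s.elim x fun j => eval (solution G j) x) d))) := by
        gcongr
        exacts [h₂ x, h₃ x, h₄ x]
      _ ≤ _ := by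
        gcongr
        have := term_le_eval_solution hG l e x
        rwa [he, monomialValue_add_single, monomialValue_add_single] at this

theorem eval_solution_ne_zero (hG : G.WellConditioned) (i : Fin m) {x : ℝ≥0∞} (hx : x ≠ 0) :
    eval (solution G i) x ≠ 0 := by
  obtain ⟨c, hc, n, -, h⟩ := exists_mul_pow_le_eval hG i
  intro h0
  have := h x
  rw [h0, nonpos_iff_eq_zero] at this
  exact mul_ne_zero hc (pow_ne_zero n hx) this

theorem eval_solution_ne_top_of_ne_top (hG : G.WellConditioned) {i : Fin m} (j : Fin m)
    {x : ℝ≥0∞} (hx : x ≠ 0) (h : eval (solution G i) x ≠ ⊤) : eval (solution G j) x ≠ ⊤ := by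
  obtain ⟨c, hc, n, hn⟩ := exists_mul_pow_mul_eval_le hG i j
  intro ht
  have := hn x
  rw [ht, ENNReal.mul_top (mul_ne_zero hc (pow_ne_zero n hx)), top_le_iff] at this
  exact h this

theorem exists_mul_pow_mul_eval_le_one (hG : G.WellConditioned) (i : Fin m) :
    ∃ c : ℝ≥0∞, c ≠ 0 ∧ ∃ n, ∀ x, x ≠ 0 → eval (solution G i) x ≠ ⊤ →
      c * x ^ n * eval (solution G i) x ≤ 1 := by
  obtain ⟨c, hc, n, hn⟩ := exists_mul_pow_mul_eval_sq_le hG i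
  refine ⟨c, hc, n, fun x hx ht => ?_⟩
  have h0 := eval_solution_ne_zero hG i hx
  have := hn x
  rw [pow_two, ← mul_assoc] at this
  exact (ENNReal.mul_le_mul_iff_left h0 ht).1 (by rwa [one_mul])

/-- A lower bound `c x ^ n` with `n ≠ 0` and an upper bound `1 / (c' x ^ n')` are incompatible for
large `x`. -/
theorem exists_bound_of_eval_ne_top (hG : G.WellConditioned) (i : Fin m) :
    ∃ M : ℝ≥0∞, M ≠ ⊤ ∧ ∀ x, eval (solution G i) x ≠ ⊤ → x ≤ M := by
  obtain ⟨c, hc, n, hn, h⟩ := exists_mul_pow_le_eval hG i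
  obtain ⟨c', hc', n', h'⟩ := exists_mul_pow_mul_eval_le_one hG i
  refine ⟨max 1 (c' * c)⁻¹, by simp [hc, hc'], fun x hx => ?_⟩
  rcases le_total x 1 with h1 | h1
  · exact h1.trans (le_max_left _ _)
  · refine le_trans ?_ (le_max_right _ _)
    rw [ENNReal.le_inv_iff_mul_le]
    have hx0 : x ≠ 0 := (zero_lt_one.trans_le h1).ne'
    calc x * (c' * c) ≤ x ^ (n' + n) * (c' * c) := by
          gcongr
          exact le_self_pow₀ h1 (by omega)
      _ = c' * x ^ n' * (c * x ^ n) := by ring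
      _ ≤ c' * x ^ n' * eval (solution G i) x := by gcongr; exact h x
      _ ≤ 1 := h' x hx0 hx

end LowerBounds

/-! ### Passage from values in `[0, ∞]` to real sums. -/

section RealValues

theorem hasSum_of_tsum_ofReal_eq {α : Type*} {f : α → ℝ} (hf : ∀ a, 0 ≤ f a) {v : ℝ} (hv : 0 ≤ v)
    (h : ∑' a, ENNReal.ofReal (f a) = ENNReal.ofReal v) : HasSum f v := by
  have hs : Summable f := by
    have := ENNReal.summable_toReal (h.trans_ne ENNReal.ofReal_ne_top)
    simpa only [ENNReal.toReal_ofReal (hf _)] using this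
  rw [← ENNReal.ofReal_tsum_of_nonneg hf hs,
    ENNReal.ofReal_eq_ofReal_iff (tsum_nonneg hf) hv] at h
  exact h ▸ hs.hasSum

theorem monomialValue_ofReal {σ : Type*} {p : σ → ℝ} (hp : ∀ s, 0 ≤ p s) (d : σ →₀ ℕ) :
    monomialValue (fun s => ENNReal.ofReal (p s)) d = ENNReal.ofReal (monomialValue p d) := by
  rw [monomialValue, monomialValue, Finsupp.prod, Finsupp.prod,
    ENNReal.ofReal_prod_of_nonneg fun s _ => pow_nonneg (hp s) _]
  exact Finset.prod_congr rfl fun s _ => (ENNReal.ofReal_pow (hp s) _).symm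

theorem mvEval_ofReal {σ : Type*} {F : MvPowerSeries σ ℝ}
    (hF : ∀ d, 0 ≤ MvPowerSeries.coeff d F) {p : σ → ℝ} (hp : ∀ s, 0 ≤ p s) :
    mvEval F (fun s => ENNReal.ofReal (p s)) = ∑' d, ENNReal.ofReal (term F p d) := by
  refine tsum_congr fun d => ?_
  rw [monomialValue_ofReal hp, term_eq, ENNReal.ofReal_mul (hF d)]

theorem eval_ofReal {f : PowerSeries ℝ} (hf : ∀ n, 0 ≤ PowerSeries.coeff n f) {x : ℝ}
    (hx : 0 ≤ x) :
    eval f (ENNReal.ofReal x) = ∑' n, ENNReal.ofReal (PowerSeries.coeff n f * x ^ n) := by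
  refine tsum_congr fun d => ?_
  rw [ENNReal.ofReal_mul (hf d), ENNReal.ofReal_pow hx]

theorem eval_ne_top_iff {f : PowerSeries ℝ} (hf : ∀ n, 0 ≤ PowerSeries.coeff n f) {x : ℝ}
    (hx : 0 ≤ x) : eval f (ENNReal.ofReal x) ≠ ⊤ ↔
      Summable fun n => PowerSeries.coeff n f * x ^ n := by
  have h0 : ∀ n, 0 ≤ PowerSeries.coeff n f * x ^ n := fun n => mul_nonneg (hf n) (pow_nonneg hx n)
  rw [eval_ofReal hf hx]
  refine ⟨fun h => ?_, fun h => ?_⟩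
  · have := ENNReal.summable_toReal h
    simpa only [ENNReal.toReal_ofReal (h0 _)] using this
  · rw [← ENNReal.ofReal_tsum_of_nonneg h0 h]
    exact ENNReal.ofReal_ne_top

theorem eval_mono (f : PowerSeries ℝ) {x y : ℝ≥0∞} (h : x ≤ y) : eval f x ≤ eval f y :=
  ENNReal.tsum_le_tsum fun n => mul_le_mul_right (pow_le_pow_left' h n) _

/-- The value of a component of the solution at a real argument. -/
noncomputable def solutionValue (G : PSSystem m) (x : ℝ) (i : Fin m) : ℝ :=
  (eval (solution G i) (ENNReal.ofReal x)).toReal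

theorem solutionValue_nonneg (x : ℝ) (i : Fin m) : 0 ≤ solutionValue G x i :=
  ENNReal.toReal_nonneg

theorem hasSum_solutionValue (hG : G.WellConditioned) {x : ℝ} (hx : 0 ≤ x) {i : Fin m}
    (h : eval (solution G i) (ENNReal.ofReal x) ≠ ⊤) :
    HasSum (fun n => PowerSeries.coeff n (solution G i) * x ^ n) (solutionValue G x i) := by
  have hn := (isStandardSolution_solution hG).nonneg i
  refine hasSum_of_tsum_ofReal_eq (fun n => mul_nonneg (hn n) (pow_nonneg hx n))
    (solutionValue_nonneg x i) ?_
  rw [← eval_ofReal hn hx, solutionValue, ENNReal.ofReal_toReal h]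

theorem point_nonneg {a : ℝ} {b : Fin m → ℝ} (ha : 0 ≤ a) (hb : ∀ i, 0 ≤ b i)
    (s : Option (Fin m)) : 0 ≤ point a b s := by
  cases s with
  | none => exact ha
  | some i => exact hb i

theorem ofReal_point (a : ℝ) (b : Fin m → ℝ) (s : Option (Fin m)) :
    ENNReal.ofReal (point a b s) = s.elim (ENNReal.ofReal a) fun i => ENNReal.ofReal (b i) := by
  cases s <;> rfl

theorem hasSum_term_solutionValue (hG : G.WellConditioned) {x : ℝ} (hx : 0 ≤ x)
    (h : ∀ i, eval (solution G i) (ENNReal.ofReal x) ≠ ⊤) (i : Fin m) :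
    HasSum (term (G i) (point x (solutionValue G x))) (solutionValue G x i) := by
  have hp := point_nonneg hx (solutionValue_nonneg (G := G) x)
  refine hasSum_of_tsum_ofReal_eq (term_nonneg (hG.nonneg i) hp) (solutionValue_nonneg x i) ?_
  rw [← mvEval_ofReal (hG.nonneg i) hp, solutionValue, ENNReal.ofReal_toReal (h i),
    eval_solution hG]
  congr 1
  funext s
  rw [ofReal_point]
  simp only [solutionValue, ENNReal.ofReal_toReal (h _)]

/-- Positive solutions of `y = G(x, y)` dominate the power series solution. -/
theorem eval_solution_le_of_hasSum (hG : G.WellConditioned) {a : ℝ} {b : Fin m → ℝ} (ha : 0 ≤ a)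
    (hb : ∀ i, 0 ≤ b i) (h : ∀ i, HasSum (term (G i) (point a b)) (b i)) (i : Fin m) :
    eval (solution G i) (ENNReal.ofReal a) ≤ ENNReal.ofReal (b i) := by
  have hp := point_nonneg ha hb
  refine eval_solution_le hG (b := fun i => ENNReal.ofReal (b i)) (fun i => ?_) i
  simp only [← ofReal_point]
  rw [mvEval_ofReal (hG.nonneg i) hp,
    ← ENNReal.ofReal_tsum_of_nonneg (term_nonneg (hG.nonneg i) hp) (h i).summable, (h i).tsum_eq]

end RealValues

/-! ### The common radius of convergence and the extreme point. -/

section ExtremePoint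

theorem exists_pos_mvEval_ne_top (hG : G.WellConditioned) :
    ∃ r : ℝ, 0 < r ∧ ∀ i, mvEval (G i) (fun _ => ENNReal.ofReal r) ≠ ⊤ := by
  obtain ⟨r, hr, h⟩ := hG.holomorphic
  refine ⟨r / 2, half_pos hr, fun i => ?_⟩
  have hs := (h i (fun _ => ((r / 2 : ℝ) : ℂ)) fun s => by
    rw [Complex.norm_real, Real.norm_of_nonneg (half_pos hr).le]; exact half_lt_self hr)
  have hs' : Summable (term (G i) fun _ => r / 2) := by
    refine Complex.summable_ofReal.1 (hs.congr fun d => ?_)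
    rw [term, Finsupp.prod, Finsupp.prod]
    push_cast
    rfl
  have hp : ∀ s : Option (Fin m), 0 ≤ (fun _ => r / 2 : Option (Fin m) → ℝ) s :=
    fun _ => (half_pos hr).le
  rw [mvEval_ofReal (hG.nonneg i) hp,
    ← ENNReal.ofReal_tsum_of_nonneg (term_nonneg (hG.nonneg i) hp) hs']
  exact ENNReal.ofReal_ne_top

/-- Every term of `G_i` contains `x`, so for `l ≤ 1` one has `G_i(l s, s, …, s) ≤ l G_i(s, s, …, s)
≤ l C`. The choice `l = s / (C + s)` makes this at most `s`, and the constant vector `s` is a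
supersolution at `x = l s`. -/
theorem exists_pos_eval_ne_top (hG : G.WellConditioned) :
    ∃ x : ℝ, 0 < x ∧ ∀ i, eval (solution G i) (ENNReal.ofReal x) ≠ ⊤ := by
  obtain ⟨r, hr, h⟩ := exists_pos_mvEval_ne_top hG
  set s := ENNReal.ofReal r
  have hs0 : s ≠ 0 := (ENNReal.ofReal_pos.2 hr).ne'
  have hst : s ≠ ⊤ := ENNReal.ofReal_ne_top
  set C := ∑ i, mvEval (G i) (fun _ => s)
  have hCt : C ≠ ⊤ := ENNReal.sum_ne_top.2 fun i _ => h i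
  set l := s / (C + s)
  have hl0 : l ≠ 0 := ENNReal.div_ne_zero.2 ⟨hs0, ENNReal.add_ne_top.2 ⟨hCt, hst⟩⟩
  have hl1 : l ≤ 1 := ENNReal.div_le_of_le_mul (by rw [one_mul]; exact le_add_self)
  have hlC : l * C ≤ s := by
    calc l * C ≤ l * (C + s) := by gcongr; exact le_self_add
      _ ≤ s := (ENNReal.div_mul_cancel (by simp [hs0]) (ENNReal.add_ne_top.2 ⟨hCt, hst⟩)).le
  have hx0 : l * s ≠ 0 := mul_ne_zero hl0 hs0
  have hxt : l * s ≠ ⊤ := ENNReal.mul_ne_top (hl1.trans_lt ENNReal.one_lt_top).ne hst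
  refine ⟨(l * s).toReal, ENNReal.toReal_pos hx0 hxt, fun i => ?_⟩
  rw [ENNReal.ofReal_toReal hxt]
  refine ((eval_solution_le hG (b := fun _ => s) (fun i => ?_) i).trans_lt hst.lt_top).ne
  refine le_trans ?_ hlC
  have hle : mvEval (G i) (fun t => t.elim (l * s) fun _ => s) ≤
      l * mvEval (G i) (fun _ => s) := by
    rw [mvEval, mvEval, ← ENNReal.tsum_mul_left]
    refine ENNReal.tsum_le_tsum fun d => ?_
    by_cases hd : d none = 0
    · simp [hG.zero_left i d hd]
    · rw [mul_left_comm]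
      gcongr
      obtain ⟨e, rfl⟩ : ∃ e, d = e + Finsupp.single none 1 := ⟨d - Finsupp.single none 1,
        (tsub_add_cancel_of_le (Finsupp.single_le_iff.2 (Nat.pos_of_ne_zero hd))).symm⟩
      rw [monomialValue_add_single, monomialValue_add_single, Option.elim_none, mul_assoc]
      gcongr
      refine monomialValue_mono_ennreal (fun t => ?_) e
      cases t with
      | none => exact mul_le_of_le_one_left' hl1
      | some j => exact le_rfl
  refine hle.trans ?_
  gcongr
  exact Finset.single_le_sum_of_canonicallyOrdered (f := fun i => mvEval (G i) fun _ => s)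
    (Finset.mem_univ i)

theorem eval_le_of_forall_lt {f : PowerSeries ℝ} {r y : ℝ} (hyr : y < r) {M : ℝ≥0∞}
    (h : ∀ x, y < x → x < r → eval f (ENNReal.ofReal x) ≤ M) : eval f (ENNReal.ofReal r) ≤ M := by
  rw [eval, ENNReal.tsum_eq_iSup_nat]
  refine iSup_le fun n => ?_
  have hcont : Continuous fun x : ℝ => ∑ k ∈ Finset.range n,
      ENNReal.ofReal (PowerSeries.coeff k f) * ENNReal.ofReal x ^ k :=
    continuous_finsetSum _ fun k _ => (ENNReal.continuous_const_mul ENNReal.ofReal_ne_top).comp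
      ((ENNReal.continuous_pow k).comp ENNReal.continuous_ofReal)
  refine le_of_tendsto ((hcont.tendsto r).mono_left (nhdsWithin_le_nhds (s := Set.Iio r))) ?_
  filter_upwards [Ioo_mem_nhdsLT hyr] with x hx
  exact (ENNReal.sum_le_tsum _).trans (h x hx.1 hx.2)

/-- The components of the solution have a common finite radius of convergence, at which they
converge. -/
theorem exists_radius (hG : G.WellConditioned) :
    ∃ r : ℝ, 0 < r ∧ (∀ i, eval (solution G i) (ENNReal.ofReal r) ≠ ⊤) ∧
      ∀ x, r < x → ∀ i, eval (solution G i) (ENNReal.ofReal x) = ⊤ := by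
  obtain ⟨i₀, -⟩ := hG.nonlinear
  obtain ⟨x₀, hx₀, h₀⟩ := exists_pos_eval_ne_top hG
  obtain ⟨M, hM, hbound⟩ := exists_bound_of_eval_ne_top hG i₀
  -- Negative `x` belong to this set, since `ENNReal.ofReal` sends them to `0`; the supremum is
  -- unaffected.
  set S := {x : ℝ | eval (solution G i₀) (ENNReal.ofReal x) ≠ ⊤}
  have hSb : BddAbove S := ⟨M.toReal, fun x hx => (ENNReal.ofReal_le_iff_le_toReal hM).1 (hbound _ hx)⟩
  set r := sSup S
  have hr0 : 0 < r := hx₀.trans_le (le_csSup hSb (h₀ i₀))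
  have hlt : ∀ x, x < r → eval (solution G i₀) (ENNReal.ofReal x) ≠ ⊤ := by
    intro x hx
    obtain ⟨y, hy, hxy⟩ := exists_lt_of_lt_csSup ⟨x₀, h₀ i₀⟩ hx
    exact ((eval_mono _ (ENNReal.ofReal_le_ofReal hxy.le)).trans_lt (lt_top_iff_ne_top.2 hy)).ne
  have hrt : eval (solution G i₀) (ENNReal.ofReal r) ≠ ⊤ := by
    obtain ⟨c, hc, n, h⟩ := exists_mul_pow_mul_eval_le_one hG i₀
    have hr2 : ENNReal.ofReal (r / 2) ≠ 0 := (ENNReal.ofReal_pos.2 (half_pos hr0)).ne'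
    -- On `(r / 2, r)` the bound `1 / (c x ^ n)` is at most `1 / (c (r / 2) ^ n)`; being uniform, it
    -- passes to the limit `r`.
    refine ((eval_le_of_forall_lt (half_lt_self hr0) (M := (c * ENNReal.ofReal (r / 2) ^ n)⁻¹)
      fun x hx hxr => ?_).trans_lt (ENNReal.inv_lt_top.2
        (pos_iff_ne_zero.2 (mul_ne_zero hc (pow_ne_zero n hr2))))).ne
    rw [ENNReal.le_inv_iff_mul_le, mul_comm]
    refine le_trans ?_ (h _ (ENNReal.ofReal_pos.2 ((half_pos hr0).trans hx)).ne' (hlt x hxr))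
    gcongr
  refine ⟨r, hr0, fun i =>
    eval_solution_ne_top_of_ne_top hG i (ENNReal.ofReal_pos.2 hr0).ne' hrt, fun x hx i => ?_⟩
  by_contra hne
  exact (le_csSup hSb (eval_solution_ne_top_of_ne_top hG i₀
    (ENNReal.ofReal_pos.2 (hr0.trans hx)).ne' hne)).not_gt hx

theorem hasRadiusOfConvergence_of_eval {f : PowerSeries ℝ} (hf : ∀ n, 0 ≤ PowerSeries.coeff n f)
    {r : ℝ} (h : eval f (ENNReal.ofReal r) ≠ ⊤)
    (h' : ∀ x, r < x → eval f (ENNReal.ofReal x) = ⊤) : HasRadiusOfConvergence f r := by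
  have habs : ∀ x : ℝ, (Summable fun n => PowerSeries.coeff n f * x ^ n) ↔
      eval f (ENNReal.ofReal |x|) ≠ ⊤ := by
    intro x
    rw [eval_ne_top_iff hf (abs_nonneg x), ← summable_abs_iff]
    simp only [abs_mul, abs_pow, abs_of_nonneg (hf _)]
  refine ⟨fun x hx => (habs x).2 ?_, fun x hx hs => (habs x).1 hs (h' _ hx)⟩
  exact ((eval_mono f (ENNReal.ofReal_le_ofReal hx.le)).trans_lt h.lt_top).ne

theorem HasRadiusOfConvergence.unique {f : PowerSeries ℝ} {r s : ℝ} (hr0 : 0 < r) (hs0 : 0 < s)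
    (hr : HasRadiusOfConvergence f r) (hs : HasRadiusOfConvergence f s) : r = s := by
  have key : ∀ {r s : ℝ}, 0 < r → HasRadiusOfConvergence f r → HasRadiusOfConvergence f s →
      ¬ r < s := by
    intro r s h0 hr hs hlt
    obtain ⟨x, hrx, hxs⟩ := exists_between hlt
    have hx := abs_of_pos (h0.trans hrx)
    exact hr.2 x (hx.symm ▸ hrx) (hs.1 x (hx.symm ▸ hxs))
  exact le_antisymm (not_lt.1 (key hs0 hs hr)) (not_lt.1 (key hr0 hr hs))

theorem isExtremePoint_iff (hG : G.WellConditioned) {r : ℝ} (hr : 0 < r)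
    (h : ∀ i, eval (solution G i) (ENNReal.ofReal r) ≠ ⊤)
    (h' : ∀ x, r < x → ∀ i, eval (solution G i) (ENNReal.ofReal x) = ⊤) (s : ℝ) (t : Fin m → ℝ) :
    IsExtremePoint G s t ↔ (s, t) = (r, solutionValue G r) := by
  have hsol := isStandardSolution_solution hG
  have hrad : ∀ i, HasRadiusOfConvergence (solution G i) r := fun i =>
    hasRadiusOfConvergence_of_eval (hsol.nonneg i) (h i) fun x hx => h' x hx i
  constructor
  · rintro ⟨T, hT, hs, hst⟩
    obtain rfl := hT.eq_solution hG
    -- Nonlinearity supplies an index; without any component the radius would be undetermined.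
    obtain ⟨i₀, -⟩ := hG.nonlinear
    obtain rfl := HasRadiusOfConvergence.unique hs hr (hst i₀).1 (hrad i₀)
    exact Prod.ext rfl (funext fun i =>
      (hst i).2.unique (hasSum_solutionValue hG hr.le (h i)))
  · intro hst
    obtain ⟨rfl, rfl⟩ := Prod.mk.inj hst
    exact ⟨solution G, hsol, hr, fun i => ⟨hrad i, hasSum_solutionValue hG hr.le (h i)⟩⟩

end ExtremePoint

end PSSystem

open Matrix

namespace PSSystem

open scoped ENNReal

variable {m : ℕ} {G : PSSystem m}

/-! ### The Jacobian at solutions, and its real eigenvalues. -/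

section Jacobian

theorem jacobian_nonneg (hG : G.WellConditioned) {a : ℝ} {b : Fin m → ℝ} (ha : 0 ≤ a)
    (hb : ∀ i, 0 ≤ b i) (i j : Fin m) : 0 ≤ jacobian G a b i j :=
  tsum_nonneg (term_nonneg (coeff_pderiv_nonneg (hG.nonneg i) _) (point_nonneg ha hb))

theorem jacobian_pos (hG : G.WellConditioned) {a : ℝ} {b : Fin m → ℝ} (ha : 0 < a)
    (hb : ∀ i, 0 < b i) {i j : Fin m} (hs : Summable (term (formalJacobian G i j) (point a b)))
    (h : formalJacobian G i j ≠ 0) : 0 < jacobian G a b i j := by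
  have hnn := coeff_pderiv_nonneg (hG.nonneg i) (some j)
  obtain ⟨d, hd⟩ := (MvPowerSeries.ne_zero_iff_exists_coeff_ne_zero _).1 h
  refine hs.tsum_pos (term_nonneg hnn (point_nonneg ha.le fun i => (hb i).le)) d ?_
  refine mul_pos ((hnn d).lt_of_ne' hd) (monomialValue_pos (fun s => ?_) d)
  cases s with
  | none => exact ha
  | some i => exact hb i

theorem point_le_point {a a' : ℝ} {b b' : Fin m → ℝ} (ha : a ≤ a') (hb : ∀ i, b i ≤ b' i)
    (s : Option (Fin m)) : point a b s ≤ point a' b' s := by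
  cases s with
  | none => exact ha
  | some i => exact hb i

theorem sum_pderiv_mul_sub (a : ℝ) (b u v : Fin m → ℝ) (i : Fin m) :
    ∑ s, (∑' d, term (MvPowerSeries.pderiv ℝ s (G i)) (point a b) d) *
      (point a v s - point a u s) = (jacobian G a b *ᵥ (v - u)) i := by
  rw [Fintype.sum_option]
  simp [point, mulVec, dotProduct, jacobian, formalJacobian]

theorem summable_of_point_ne {a a' : ℝ} {b u v : Fin m → ℝ} {i : Fin m}
    (h : ∀ j, Summable (term (formalJacobian G i j) (point a b))) (s : Option (Fin m))
    (hs : point a' u s ≠ point a' v s) :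
    Summable (term (MvPowerSeries.pderiv ℝ s (G i)) (point a b)) := by
  cases s with
  | none => exact absurd rfl hs
  | some j => exact h j

/-- If the solution `u` at `x = a` lies below the solution `b` at the larger argument `r`, then the
difference is strictly superinvariant for the Jacobian at `(a, u)`. -/
theorem jacobian_mulVec_sub_lt (hG : G.WellConditioned) {a r : ℝ} (ha : 0 ≤ a) (har : a < r)
    {u b : Fin m → ℝ} (hu : ∀ i, 0 ≤ u i) (hub : ∀ i, u i ≤ b i) {i : Fin m}
    (hus : HasSum (term (G i) (point a u)) (u i)) (hbs : HasSum (term (G i) (point r b)) (b i))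
    (hJ : ∀ j, Summable (term (formalJacobian G i j) (point a u))) :
    (jacobian G a u *ᵥ (b - u)) i < (b - u) i := by
  obtain ⟨n, hn, hc⟩ := exists_coeff_single_ne_zero hG i
  have hb : ∀ i, 0 ≤ b i := fun i => (hu i).trans (hub i)
  -- Passing from `(a, b)` to `(r, b)` is a strict increase because of the pure power of `x` in
  -- `G_i`; passing from `(a, u)` to `(a, b)` gains at least the derivative at the lower end.
  have h1 := tsum_term_lt (hG.nonneg i) (point_nonneg ha hb)
    (point_le_point har.le fun _ => le_rfl) hbs.summable hn hc har
  have h2 := le_tsum_term_sub (hG.nonneg i) (point_nonneg ha hu) (point_le_point le_rfl hub)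
    (summable_term_of_le (hG.nonneg i) (point_nonneg ha hb)
      (point_le_point har.le fun _ => le_rfl) hbs.summable) (summable_of_point_ne hJ)
  rw [sum_pderiv_mul_sub, hus.tsum_eq] at h2
  rw [hbs.tsum_eq] at h1
  rw [Pi.sub_apply]
  linarith

theorem mul_abs_le_mulVec_abs {A : Matrix (Fin m) (Fin m) ℝ} (hA : ∀ i j, 0 ≤ A i j) {t : ℝ}
    {w : Fin m → ℝ} (h : A *ᵥ w = t • w) (i : Fin m) : t * |w i| ≤ (A *ᵥ fun j => |w j|) i := by
  calc t * |w i| ≤ |t| * |w i| := mul_le_mul_of_nonneg_right (le_abs_self t) (abs_nonneg _)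
    _ = |(A *ᵥ w) i| := by rw [h, Pi.smul_apply, smul_eq_mul, abs_mul]
    _ ≤ ∑ j, |A i j * w j| := Finset.abs_sum_le_sum_abs (fun j => A i j * w j) Finset.univ
    _ = _ := Finset.sum_congr rfl fun j _ => by rw [abs_mul, abs_of_nonneg (hA i j)]

theorem exists_nonneg_mul_le_mulVec {A : Matrix (Fin m) (Fin m) ℝ} (hA : ∀ i j, 0 ≤ A i j) {t : ℝ}
    (h : Module.End.HasEigenvalue (toLin' A) t) :
    ∃ w : Fin m → ℝ, (∀ i, 0 ≤ w i) ∧ w ≠ 0 ∧ ∀ i, t * w i ≤ (A *ᵥ w) i := by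
  obtain ⟨w, hw⟩ := h.exists_hasEigenvector
  refine ⟨fun i => |w i|, fun i => abs_nonneg _, fun h0 => hw.2 (funext fun i => ?_),
    mul_abs_le_mulVec_abs hA ?_⟩
  · exact abs_eq_zero.1 (congrFun h0 i)
  · simpa using hw.apply_eq_smul

theorem hasEigenvalue_one_of_det_eq_zero {A : Matrix (Fin m) (Fin m) ℝ} (h : (1 - A).det = 0) :
    Module.End.HasEigenvalue (toLin' A) 1 := by
  obtain ⟨v, hv, h0⟩ := exists_mulVec_eq_zero_iff.2 h
  refine Module.End.hasEigenvalue_of_hasEigenvector (x := v)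
    ⟨Module.End.mem_eigenspace_iff.2 ?_, hv⟩
  rw [sub_mulVec, one_mulVec, sub_eq_zero] at h0
  rw [toLin'_apply, one_smul, ← h0]

end Jacobian

/-! ### Characteristic points and the eigenvalue criterion. -/

section CharacteristicPoint

variable {r : ℝ}

theorem solutionValue_le_solutionValue {x y : ℝ} (hxy : x ≤ y) {i : Fin m}
    (h : eval (solution G i) (ENNReal.ofReal y) ≠ ⊤) :
    solutionValue G x i ≤ solutionValue G y i :=
  ENNReal.toReal_mono h (eval_mono _ (ENNReal.ofReal_le_ofReal hxy))

theorem eval_ne_top_of_le {x : ℝ} (hxr : x ≤ r)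
    (h : ∀ i, eval (solution G i) (ENNReal.ofReal r) ≠ ⊤) (i : Fin m) :
    eval (solution G i) (ENNReal.ofReal x) ≠ ⊤ :=
  ((eval_mono _ (ENNReal.ofReal_le_ofReal hxr)).trans_lt (h i).lt_top).ne

theorem solutionValue_lt_solutionValue (hG : G.WellConditioned) {x : ℝ} (hx : 0 ≤ x) (hxr : x < r)
    (h : ∀ i, eval (solution G i) (ENNReal.ofReal r) ≠ ⊤) (i : Fin m) :
    solutionValue G x i < solutionValue G r i := by
  obtain ⟨n, hn, hc⟩ := exists_coeff_single_ne_zero hG i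
  have h1 := hasSum_term_solutionValue hG hx (eval_ne_top_of_le hxr.le h) i
  have h2 := hasSum_term_solutionValue hG (hx.trans hxr.le) h i
  rw [← h1.tsum_eq, ← h2.tsum_eq]
  exact tsum_term_lt (hG.nonneg i) (point_nonneg hx (solutionValue_nonneg x))
    (point_le_point hxr.le fun j => solutionValue_le_solutionValue hxr.le (h j))
    h2.summable hn hc hxr

theorem tendsto_solutionValue (hG : G.WellConditioned) (hr : 0 < r)
    (h : ∀ i, eval (solution G i) (ENNReal.ofReal r) ≠ ⊤) (i : Fin m) :
    Filter.Tendsto (fun x => solutionValue G x i) (nhdsWithin r (Set.Iio r))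
      (nhds (solutionValue G r i)) := by
  have hn := (isStandardSolution_solution hG).nonneg i
  have hsr := hasSum_solutionValue hG hr.le (h i)
  have key : Filter.Tendsto (fun x : ℝ => ∑' n, PowerSeries.coeff n (solution G i) * x ^ n)
      (nhdsWithin r (Set.Iio r)) (nhds (∑' n, PowerSeries.coeff n (solution G i) * r ^ n)) := by
    refine tendsto_tsum_of_dominated_convergence hsr.summable (fun n => ?_) ?_
    · exact ((continuous_const.mul (continuous_pow n)).tendsto r).mono_left nhdsWithin_le_nhds
    · filter_upwards [Ioo_mem_nhdsLT hr] with x hx n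
      rw [Real.norm_of_nonneg (mul_nonneg (hn n) (pow_nonneg hx.1.le n))]
      exact mul_le_mul_of_nonneg_left (pow_le_pow_left₀ hx.1.le hx.2.le n) (hn n)
  rw [hsr.tsum_eq] at key
  refine key.congr' ?_
  filter_upwards [Ioo_mem_nhdsLT hr] with x hx
  exact (hasSum_solutionValue hG hx.1.le (eval_ne_top_of_le hx.2.le h i)).tsum_eq

theorem tendsto_jacobian (hG : G.WellConditioned) (hr : 0 < r)
    (h : ∀ i, eval (solution G i) (ENNReal.ofReal r) ≠ ⊤) {i j : Fin m}
    (hJ : Summable (term (formalJacobian G i j) (point r (solutionValue G r)))) :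
    Filter.Tendsto (fun x => jacobian G x (solutionValue G x) i j) (nhdsWithin r (Set.Iio r))
      (nhds (jacobian G r (solutionValue G r) i j)) := by
  have hnn : ∀ d, 0 ≤ MvPowerSeries.coeff d (formalJacobian G i j) :=
    coeff_pderiv_nonneg (hG.nonneg i) (some j)
  refine tendsto_tsum_of_dominated_convergence hJ (fun d => ?_) ?_
  · refine Filter.Tendsto.const_mul _ (tendsto_finsetProd _ fun s _ => Filter.Tendsto.pow ?_ _)
    cases s with
    | none => exact (continuous_id.tendsto r).mono_left nhdsWithin_le_nhds
    | some k => exact tendsto_solutionValue hG hr h k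
  · filter_upwards [Ioo_mem_nhdsLT hr] with x hx d
    have hp := point_nonneg hx.1.le (solutionValue_nonneg (G := G) x)
    rw [Real.norm_of_nonneg (term_nonneg hnn hp d)]
    exact term_mono hnn hp
      (point_le_point hx.2.le fun k => solutionValue_le_solutionValue hx.2.le (h k)) d

theorem isLargestRealEigenvalue_one (hG : G.WellConditioned) (hr : 0 < r)
    (h : ∀ i, eval (solution G i) (ENNReal.ofReal r) ≠ ⊤)
    (hc : IsCharacteristicPoint G r (solutionValue G r)) :
    IsLargestRealEigenvalue (jacobian G r (solutionValue G r)) 1 := by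
  refine ⟨hasEigenvalue_one_of_det_eq_zero hc.det_eq_zero, fun t ht => ?_⟩
  by_contra! hlt
  -- The slack between `s` and `t` is what survives the passage from `r` to a nearby `x < r`.
  obtain ⟨s, hs1, hst⟩ := exists_between hlt
  obtain ⟨w, hw, hw0, hle⟩ := exists_nonneg_mul_le_mulVec
    (jacobian_nonneg hG hr.le (solutionValue_nonneg r)) ht
  have hev : ∀ᶠ x in nhdsWithin r (Set.Iio r),
      ∀ i, s * w i ≤ (jacobian G x (solutionValue G x) *ᵥ w) i := by
    refine Filter.eventually_all.2 fun i => ?_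
    -- Where `w i = 0` there is no slack, but the inequality is trivial.
    rcases (hw i).eq_or_lt with h0 | h0
    · filter_upwards [Ioo_mem_nhdsLT hr] with x hxr
      rw [← h0, mul_zero, mulVec, dotProduct]
      exact Finset.sum_nonneg fun j _ => mul_nonneg
        (jacobian_nonneg hG hxr.1.le (solutionValue_nonneg x) i j) (hw j)
    · have ht : Filter.Tendsto (fun x => (jacobian G x (solutionValue G x) *ᵥ w) i)
          (nhdsWithin r (Set.Iio r)) (nhds ((jacobian G r (solutionValue G r) *ᵥ w) i)) :=
        tendsto_finsetSum Finset.univ fun j _ =>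
          (tendsto_jacobian hG hr h (hc.summable_jacobian i j)).mul_const _
      filter_upwards [ht.eventually_const_lt ((mul_lt_mul_of_pos_right hst h0).trans_le (hle i))]
        with x hx
      exact hx.le
  obtain ⟨x, hx, hx0, hxr⟩ := (hev.and (Ioo_mem_nhdsLT hr)).exists
  have hlt := solutionValue_lt_solutionValue hG hx0.le hxr h
  obtain ⟨i, hi⟩ := exists_mul_le_mulVec_of_mul_le_mulVec
    (jacobian_nonneg hG hx0.le (solutionValue_nonneg x))
    (v := solutionValue G r - solutionValue G x) (fun i => sub_pos.2 (hlt i)) hw hw0 hx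
  have hi' := jacobian_mulVec_sub_lt hG hx0.le hxr (solutionValue_nonneg x) (fun i => (hlt i).le)
    (hasSum_term_solutionValue hG hx0.le (eval_ne_top_of_le hxr.le h) i) (hc.hasSum i)
    fun j => summable_term_of_le (coeff_pderiv_nonneg (hG.nonneg i) (some j))
      (point_nonneg hx0.le (solutionValue_nonneg x))
      (point_le_point hxr.le fun k => (hlt k).le) (hc.summable_jacobian i j)
  have hpos : 0 < (solutionValue G r - solutionValue G x) i := sub_pos.2 (hlt i)
  nlinarith

/-- At a characteristic point where the largest real eigenvalue is `1`, the `y`-coordinates are the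
values of the power series solution. -/
theorem eq_solutionValue_of_isLargestRealEigenvalue (hG : G.WellConditioned) {a : ℝ}
    {b : Fin m → ℝ} (hc : IsCharacteristicPoint G a b)
    (hl : IsLargestRealEigenvalue (jacobian G a b) 1)
    (hfin : ∀ i, eval (solution G i) (ENNReal.ofReal a) ≠ ⊤)
    (hle : ∀ i, solutionValue G a i ≤ b i) : b = solutionValue G a := by
  have ha := hc.pos_left.le
  have hb : ∀ i, 0 ≤ b i := fun i => (hc.pos_right i).le
  set u := solutionValue G a
  have hu0 : ∀ i, 0 ≤ u i := solutionValue_nonneg a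
  have hus : ∀ i, HasSum (term (G i) (point a u)) (u i) := hasSum_term_solutionValue hG ha hfin
  by_contra hne
  have hJh : ∀ i, (b - u) i ≤ (jacobian G a b *ᵥ (b - u)) i := by
    intro i
    have := tsum_term_sub_le (hG.nonneg i) (point_nonneg ha hu0) (point_le_point le_rfl hle)
      (hc.hasSum i).summable (summable_of_point_ne (hc.summable_jacobian i))
    rwa [sum_pderiv_mul_sub, (hus i).tsum_eq, (hc.hasSum i).tsum_eq] at this
  have hirr : ∀ i j, Relation.TransGen (fun k l => 0 < jacobian G a b k l) i j := fun i j =>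
    (hG.irreducible i j).lift id fun k l hkl =>
      jacobian_pos hG hc.pos_left hc.pos_right (hc.summable_jacobian k l) hkl
  obtain ⟨hfix, hpos⟩ := mulVec_eq_and_pos_of_le_mulVec (jacobian_nonneg hG ha hb) hirr
    (fun t ht => hl.2 ht) (h := b - u) (fun i => sub_nonneg.2 (hle i)) (sub_ne_zero.2 hne) hJh
  obtain ⟨i, j, k, hijk⟩ := hG.nonlinear
  have hb0 : ∀ s, 0 < point a b s := fun s => by
    cases s with
    | none => exact hc.pos_left
    | some i => exact hc.pos_right i
  -- All components of `b - u` are positive, so the second derivative makes row `i` strict,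
  -- contradicting `hfix`.
  have := tsum_term_sub_lt (hG.nonneg i) (point_nonneg ha hu0) (point_le_point le_rfl hle) hb0
    (hc.hasSum i).summable (summable_of_point_ne (hc.summable_jacobian i)) hijk
    (sub_pos.1 (hpos j)) (sub_pos.1 (hpos k))
  rw [sum_pderiv_mul_sub, (hus i).tsum_eq, (hc.hasSum i).tsum_eq, hfix] at this
  exact this.false

theorem eq_of_isLargestRealEigenvalue (hG : G.WellConditioned)
    (h : ∀ i, eval (solution G i) (ENNReal.ofReal r) ≠ ⊤)
    (h' : ∀ x, r < x → ∀ i, eval (solution G i) (ENNReal.ofReal x) = ⊤) {a : ℝ} {b : Fin m → ℝ}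
    (hc : IsCharacteristicPoint G a b) (hl : IsLargestRealEigenvalue (jacobian G a b) 1) :
    (a, b) = (r, solutionValue G r) := by
  obtain ⟨i₀, -⟩ := hG.nonlinear
  have ha := hc.pos_left.le
  have hle : ∀ i, eval (solution G i) (ENNReal.ofReal a) ≤ ENNReal.ofReal (b i) :=
    eval_solution_le_of_hasSum hG ha (fun i => (hc.pos_right i).le) hc.hasSum
  have hfin : ∀ i, eval (solution G i) (ENNReal.ofReal a) ≠ ⊤ := fun i =>
    ((hle i).trans_lt ENNReal.ofReal_lt_top).ne
  obtain rfl := eq_solutionValue_of_isLargestRealEigenvalue hG hc hl hfin fun i =>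
    ENNReal.toReal_le_of_le_ofReal (hc.pos_right i).le (hle i)
  have har : a ≤ r := not_lt.1 fun hlt => hfin i₀ (h' a hlt i₀)
  -- For `a < r`, the positive vector `S(r) - S(a)` is strictly decreased by the Jacobian, which is
  -- incompatible with the eigenvalue `1`.
  obtain rfl : a = r := by
    by_contra hne
    have hlt := har.lt_of_ne hne
    have hval := solutionValue_lt_solutionValue hG ha hlt h
    obtain ⟨w, hw, hw0, hwle⟩ := exists_nonneg_mul_le_mulVec
      (jacobian_nonneg hG ha (solutionValue_nonneg a)) hl.1
    obtain ⟨i, hi⟩ := exists_mul_le_mulVec_of_mul_le_mulVec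
      (jacobian_nonneg hG ha (solutionValue_nonneg a))
      (v := solutionValue G r - solutionValue G a) (fun i => sub_pos.2 (hval i)) hw hw0 hwle
    rw [one_mul] at hi
    exact (jacobian_mulVec_sub_lt hG ha hlt (solutionValue_nonneg a) (fun i => (hval i).le)
      (hc.hasSum i) (hasSum_term_solutionValue hG (ha.trans har) h i)
      (hc.summable_jacobian i)).not_ge hi
  rfl

end CharacteristicPoint

end PSSystem

theorem mainTheorem2 {m : ℕ} (G : PSSystem m) (hG : G.WellConditioned) :
    ∃ (ρ : ℝ) (τ : Fin m → ℝ),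
      (∀ (r : ℝ) (t : Fin m → ℝ), PSSystem.IsExtremePoint G r t ↔ (r, t) = (ρ, τ)) ∧
      ∀ (a : ℝ) (b : Fin m → ℝ), PSSystem.IsCharacteristicPoint G a b →
        (PSSystem.IsLargestRealEigenvalue (PSSystem.jacobian G a b) 1 ↔ (a, b) = (ρ, τ)) := by
  obtain ⟨r, hr, h, h'⟩ := PSSystem.exists_radius hG
  refine ⟨r, PSSystem.solutionValue G r, PSSystem.isExtremePoint_iff hG hr h h',
    fun a b hc => ⟨PSSystem.eq_of_isLargestRealEigenvalue hG h h' hc, fun hab => ?_⟩⟩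
  obtain ⟨rfl, rfl⟩ := Prod.mk.inj hab
  exact PSSystem.isLargestRealEigenvalue_one hG hr h hc
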